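/- Let $\varepsilon>0$, $\mathbb{D}_\varepsilon=\{(x,y)\in\mathbb{R}^2: x^2+y^2<\varepsilon^2\}$. Let $p:\mathbb{R}\times\mathbb{D}_\varepsilon\to\mathbb{R}$ be $1$-periodic in $t$ and of class $\mathcal{C}^{0,2}$, that is, $\mathcal{C}^2$ in $(x,y)$ with $p$ and all its spatial partial derivatives up to order $2$ continuous in $(t,x,y)$. Suppose that the origin is a zero of order $4$ of $p$: one can write $p=T_4+\tilde p$ on $\mathbb{R}\times\mathbb{D}_\varepsilon$ with $T_4,\tilde p\in\mathcal{C}^{0,2}(\mathbb{R}\times\mathbb{D}_\varepsilon)$, where $T_4(t,x,y)=\sum_{i+j=4}\alpha_{i,j}(t)x^iy^j$ has coefficients $\alpha_{i,j}\in\mathcal{C}^1(\mathbb{R})$, and where for some constant $C$ and all $(t,x,y)\in\mathbb{R}\times\mathbb{D}_\varepsilon$ one has $|\tilde p(t,x,y)|\le C(|x|^5+|y|^5)$ and, for $m=1,2$, every spatial partial derivative of order $m$ of $\tilde p$ at $(t,x,y)$ is bounded in absolute value by $C(|x|^{5-m}+|y|^{5-m})$. The change of variables $x=\cos\theta/\sqrt{2r}$,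 $y=-\sin\theta/\sqrt{2r}$ transforms the Hamiltonian system $\dot x=\partial_y\Psi$, $\dot y=-\partial_x\Psi$, $\Psi=\tfrac12\ln(x^2+y^2)+p(t,x,y)$, into the regularized system $$\dot r=4r^2\,\partial_\theta h(t,r,\theta),\qquad \dot\theta=2r-4r^2\,\partial_r h(t,r,\theta),\qquad h(t,r,\theta)=p\Big(t,\tfrac{\cos\theta}{\sqrt{2r}},-\tfrac{\sin\theta}{\sqrt{2r}}\Big),$$ on $r>r_*:=\frac1{2\varepsilon^2}$, $\theta\in\mathbb{R}/2\pi\mathbb{Z}$ (below, $\theta$ is lifted to $\mathbb{R}$). Then there is $a>r_*$ such that for all $r_0>a$ and $\theta_0\in\mathbb{R}$ there is exactly one solution $(r(t),\theta(t))$ of this system on $[0,1]$ with values in $r>r_*$ and $(r(0),\theta(0))=(r_0,\theta_0)$. The Poincaré map $\mathcal{P}(r_0,\theta_0)=(r(1),\theta(1))=(\mathcal{F}(r_0,\theta_0),\mathcal{G}(r_0,\theta_0))$, thus defined for $r_0>a$, satisfies $\mathcal{P}(r_0,\theta_0+2\pi)=\mathcal{P}(r_0,\theta_0)+(0,2\pi)$,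 the partial derivative $\partial\mathcal{G}/\partial r_0$ exists for all $r_0>a$, $\theta_0\in\mathbb{R}$, and $$\frac{\partial\mathcal{G}}{\partial r_0}(r_0,\theta_0)\longrightarrow 2\quad\text{as } r_0\to\infty,\ \text{uniformly in }\theta_0 .$$ In particular $\mathcal{P}$ is twist near the singularity: there is $a_2\ge a$ such that $\frac{\partial\mathcal{G}}{\partial r_0}(r_0,\theta_0)>0$ for all $r_0>a_2$ and all $\theta_0$. -/

import Mathlib

open Set Filter Topology

noncomputable section

namespace Vortex

/-- The open Euclidean disk of radius `ε` around the origin of the plane. -/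
def disk (ε : ℝ) : Set (ℝ × ℝ) := {z | z.1 ^ 2 + z.2 ^ 2 < ε ^ 2}

/-- The class `C^{0,k}(ℝ × 𝔻_ε)`: `f t` is `C^k` in the spatial variables, and all the spatial
derivatives up to order `k` (including `f` itself, `m = 0`) are jointly continuous in `(t, x, y)`. -/
def IsC0k (k : ℕ) (ε : ℝ) (f : ℝ → ℝ × ℝ → ℝ) : Prop :=
  (∀ t, ContDiffOn ℝ k (f t) (disk ε)) ∧
  ∀ m ≤ k, ContinuousOn (fun q : ℝ × (ℝ × ℝ) => iteratedFDeriv ℝ m (f q.1) q.2)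
    (univ ×ˢ disk ε)

/-- The class `𝓡^k_ε`: functions in `C^{0,k}(ℝ × 𝔻_ε)` that are `1`-periodic in time. -/
def ClassR (k : ℕ) (ε : ℝ) (f : ℝ → ℝ × ℝ → ℝ) : Prop :=
  (∀ t, ∀ z ∈ disk ε, f (t + 1) z = f t z) ∧ IsC0k k ε f

/-- The origin is a zero of order `N` of `f` (used for `k ≤ N`, so that the subtraction
in the exponent is the usual one). The norm of the `m`-th Fréchet derivative bounds, and is bounded
by a constant times, the largest partial derivative of order `m`. -/
def IsZeroOfOrder (N k : ℕ) (ε : ℝ) (f : ℝ → ℝ × ℝ → ℝ) : Prop :=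
  ∃ T g : ℝ → ℝ × ℝ → ℝ,
    IsC0k k ε T ∧ IsC0k k ε g ∧
    (∀ t, ∀ z ∈ disk ε, f t z = T t z + g t z) ∧
    (∃ α : ℕ → ℕ → ℝ → ℝ,
      (∀ i j, i + j = N → ContDiff ℝ 1 (α i j)) ∧
      ∀ t, ∀ z ∈ disk ε,
        T t z = ∑ ij ∈ Finset.HasAntidiagonal.antidiagonal N, α ij.1 ij.2 t * z.1 ^ ij.1 * z.2 ^ ij.2) ∧
    ∃ C : ℝ, ∀ t, ∀ z ∈ disk ε,
      |g t z| ≤ C * (|z.1| ^ (N + 1) + |z.2| ^ (N + 1)) ∧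
      ∀ m, 1 ≤ m → m ≤ k →
        ‖iteratedFDeriv ℝ m (g t) z‖ ≤ C * (|z.1| ^ (N + 1 - m) + |z.2| ^ (N + 1 - m))

/-- The lower end `r_* = 1 / (2 ε²)` of the range of the regularized radial variable `r`. -/
def rStar (ε : ℝ) : ℝ := 1 / (2 * ε ^ 2)

/-- The perturbation in the regularized variables,
`h(t, r, θ) = p(t, cos θ / √(2r), - sin θ / √(2r))`. -/
def pert (p : ℝ → ℝ × ℝ → ℝ) (t r θ : ℝ) : ℝ :=
  p t (Real.cos θ / √(2 * r), -Real.sin θ / √(2 * r))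

/-- `F = 4 r² ∂_θ h`. -/
def fieldF (p : ℝ → ℝ × ℝ → ℝ) (t r θ : ℝ) : ℝ :=
  4 * r ^ 2 * deriv (fun ϑ => pert p t r ϑ) θ

/-- `G = - 4 r² ∂_r h`. -/
def fieldG (p : ℝ → ℝ × ℝ → ℝ) (t r θ : ℝ) : ℝ :=
  -4 * r ^ 2 * deriv (fun ρ => pert p t ρ θ) r

/-- `γ = (r, θ)` is a solution on `[0, 1]`, inside the domain `r > r_*`, of the regularized system
`r' = F(t, r, θ)`, `θ' = 2 r + G(t, r, θ)`, with `γ 0 = (r₀, θ₀)`; the angle is lifted to `ℝ`. -/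
structure IsSolution (p : ℝ → ℝ × ℝ → ℝ) (ε r₀ θ₀ : ℝ) (γ : ℝ → ℝ × ℝ) : Prop where
  init : γ 0 = (r₀, θ₀)
  mem : ∀ t ∈ Icc (0 : ℝ) 1, rStar ε < (γ t).1
  ode : ∀ t ∈ Icc (0 : ℝ) 1, HasDerivWithinAt γ
    (fieldF p t (γ t).1 (γ t).2, 2 * (γ t).1 + fieldG p t (γ t).1 (γ t).2) (Icc 0 1) t

/-- There is one and only one solution on `[0, 1]` starting at `(r₀, θ₀)`. -/
def UniquelySolvable (p : ℝ → ℝ × ℝ → ℝ) (ε r₀ θ₀ : ℝ) : Prop :=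
  ∃ γ, IsSolution p ε r₀ θ₀ γ ∧ ∀ γ', IsSolution p ε r₀ θ₀ γ' → EqOn γ' γ (Icc 0 1)

open Classical in
/-- The (lifted) Poincaré map: the value at time `1` of the solution starting at `(r₀, θ₀)`. The
value where there is no solution on `[0, 1]` is immaterial. -/
def poincare (p : ℝ → ℝ × ℝ → ℝ) (ε r₀ θ₀ : ℝ) : ℝ × ℝ :=
  if h : ∃ γ, IsSolution p ε r₀ θ₀ γ then h.choose 1 else (r₀, θ₀)

/-- The angular component `𝒢` of the Poincaré map. -/
def angular (p : ℝ → ℝ × ℝ → ℝ) (ε r₀ θ₀ : ℝ) : ℝ := (poincare p ε r₀ θ₀).2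

/-- The partial derivative `∂𝒢/∂r₀` at `(r₀, θ₀)`. -/
def angularDr (p : ℝ → ℝ × ℝ → ℝ) (ε r₀ θ₀ : ℝ) : ℝ :=
  deriv (fun ρ => angular p ε ρ θ₀) r₀

end Vortex

end

namespace Vortex

/-! ### Differential equations on the unit time interval: existence, dependence on initial data,
averaging -/

section ODE

variable {E : Type*} [NormedAddCommGroup E] [NormedSpace ℝ E]

/-! In the variables `(r, θ)` a quartic form becomes `Q(t, θ) / (4 r²)`. The weight `4 r²` therefore
leaves `∂_θ Q` of order one in `r'`, and `2 Q / r` in `θ'`. The remainder vanishes to fifth order,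
so its contribution and the spatial derivative of that contribution are `O(1/√r)`. The system is
thus `r' = B(t, θ) + f`, `θ' = 2 r + g`, with `B = ∂_θ Q` bounded and `f`, `g` small in the `C¹`
sense (`exists_twistBounds`).

Since `r'` is bounded, `r` moves by a bounded amount on `[0, 1]`. Orbits starting far out stay in
the domain, and a global Lipschitz bound makes them unique. The derivative of the flow in `r₀`
solves the variational equation along the orbit, with initial value `(1, 0)`
(`hasDerivAt_solution_initial`).

The obstacle is that its coefficient `∂_θ B` is not small, so the equation is not close to `u' = 0`,
`v' = 2 u` pointwise. It does oscillate fast: as `θ' ≈ 2 r`, the quantity `β = B / (2 r)` has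
derivative `∂_θ B + O(1/√r)` while `β = O(1/r)` (`hasDerivWithinAt_primitive`). This is where the
`C¹` dependence of the coefficients on time enters. Replacing `u` by `u - β v` removes the large
term, and Gronwall's inequality gives `v(1) = 2 + O(1/√r₀)` uniformly in the angle
(`abs_sub_two_le_of_small_primitive`, `abs_variation_sub_le`). -/

theorem hasDerivWithinAt_Ici_of_Icc {f : ℝ → E} {f' : E} {t : ℝ} (ht : t ∈ Ico (0 : ℝ) 1)
    (h : HasDerivWithinAt f f' (Icc 0 1) t) : HasDerivWithinAt f f' (Ici t) t :=
  h.mono_of_mem_nhdsWithin (Icc_mem_nhdsGE_of_mem ht)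

theorem hasDerivWithinAt_fst {γ : ℝ → ℝ × ℝ} {v : ℝ × ℝ} {s : Set ℝ} {t : ℝ}
    (h : HasDerivWithinAt γ v s t) : HasDerivWithinAt (fun t => (γ t).1) v.1 s t :=
  (ContinuousLinearMap.fst ℝ ℝ ℝ).hasFDerivAt.comp_hasDerivWithinAt t h

theorem hasDerivWithinAt_snd {γ : ℝ → ℝ × ℝ} {v : ℝ × ℝ} {s : Set ℝ} {t : ℝ}
    (h : HasDerivWithinAt γ v s t) : HasDerivWithinAt (fun t => (γ t).2) v.2 s t :=
  (ContinuousLinearMap.snd ℝ ℝ ℝ).hasFDerivAt.comp_hasDerivWithinAt t h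

theorem hasDerivAt_snd {γ : ℝ → ℝ × ℝ} {v : ℝ × ℝ} {t : ℝ} (h : HasDerivAt γ v t) :
    HasDerivAt (fun t => (γ t).2) v.2 t :=
  (ContinuousLinearMap.snd ℝ ℝ ℝ).hasFDerivAt.comp_hasDerivAt t h

theorem exists_solution_of_lipschitz_of_bounded [CompleteSpace E] {V : ℝ → E → E} {K : NNReal}
    {N : ℝ} (hV : ∀ t ∈ Icc (0 : ℝ) 1, LipschitzWith K (V t))
    (hc : ∀ x, ContinuousOn (fun t => V t x) (Icc 0 1))
    (hN : ∀ t ∈ Icc (0 : ℝ) 1, ∀ x, ‖V t x‖ ≤ N) (x₀ : E) :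
    ∃ γ : ℝ → E, γ 0 = x₀ ∧
      ∀ t ∈ Icc (0 : ℝ) 1, HasDerivWithinAt γ (V t (γ t)) (Icc 0 1) t := by
  have h0 : (0 : ℝ) ∈ Icc (0 : ℝ) 1 := by simp
  have hN0 : 0 ≤ N := (norm_nonneg _).trans (hN 0 h0 x₀)
  -- The ball has radius `N`, equal to the speed bound: in unit time a solution cannot leave it, so
  -- the local theorem already covers `[0, 1]`.
  have hP : IsPicardLindelof V (⟨0, h0⟩ : Icc (0 : ℝ) 1) x₀ ⟨N, hN0⟩ 0 ⟨N, hN0⟩ K :=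
    { lipschitzOnWith := fun t ht => (hV t ht).lipschitzOnWith
      continuousOn := fun x _ => hc x
      norm_le := fun t ht x _ => hN t ht x
      mul_max_le := by simp }
  exact hP.exists_eq_forall_mem_Icc_hasDerivWithinAt₀

/-- Truncation of a real number to `[a, b]`. -/
def clip (a b x : ℝ) : ℝ := max a (min b x)

theorem clip_of_mem {a b x : ℝ} (h : x ∈ Icc a b) : clip a b x = x := by
  simp [clip, h.1, h.2]

theorem clip_mem {a b : ℝ} (h : a ≤ b) (x : ℝ) : clip a b x ∈ Icc a b :=
  ⟨le_max_left _ _, max_le h (min_le_left _ _)⟩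

theorem lipschitzWith_clip (a b : ℝ) : LipschitzWith 1 (clip a b) :=
  (LipschitzWith.id.const_min b).const_max a

theorem abs_clip_le {R : ℝ} (hR : 0 ≤ R) (x : ℝ) : |clip (-R) R x| ≤ |x| := by
  unfold clip
  rcases le_total R x with h | h
  · rw [min_eq_left h, max_eq_right (by linarith), abs_of_nonneg hR]
    exact h.trans (le_abs_self x)
  · rw [min_eq_right h]
    rcases le_total (-R) x with h' | h'
    · rw [max_eq_right h']
    · rw [max_eq_left h', abs_neg, abs_of_nonneg hR]
      linarith [neg_le_abs x]

/-- A linear field is unbounded, so it is first truncated outside the a priori Gronwall ball of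
radius `‖e‖ exp L`. Truncation does not increase norms, so the truncated solution obeys the same
bound and never meets the truncation. -/
theorem exists_solution_linear {A : ℝ → ℝ × ℝ →L[ℝ] ℝ × ℝ} (hA : ContinuousOn A (Icc 0 1))
    (e : ℝ × ℝ) :
    ∃ X : ℝ → ℝ × ℝ, X 0 = e ∧
      ∀ t ∈ Icc (0 : ℝ) 1, HasDerivWithinAt X (A t (X t)) (Icc 0 1) t := by
  obtain ⟨L, hL⟩ := isCompact_Icc.exists_bound_of_continuousOn hA
  have hL0 : 0 ≤ L := (norm_nonneg _).trans (hL 0 (by simp))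
  set R := ‖e‖ * Real.exp L with hR
  have hR0 : 0 ≤ R := by positivity
  set κ : ℝ × ℝ → ℝ × ℝ := fun x => (clip (-R) R x.1, clip (-R) R x.2) with hκ
  have hκ1 : LipschitzWith 1 κ := by
    have h1 := (lipschitzWith_clip (-R) R).comp (LipschitzWith.prod_fst (α := ℝ) (β := ℝ))
    have h2 := (lipschitzWith_clip (-R) R).comp (LipschitzWith.prod_snd (α := ℝ) (β := ℝ))
    simpa using h1.prodMk h2
  have hκR : ∀ x, ‖κ x‖ ≤ R := fun x => by
    have h := fun y => abs_le.2 (clip_mem (by linarith : -R ≤ R) y)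
    simpa [hκ, Prod.norm_def] using ⟨h x.1, h x.2⟩
  have hκn : ∀ x, ‖κ x‖ ≤ ‖x‖ := fun x => by
    simp only [hκ, Prod.norm_def, Real.norm_eq_abs]
    exact max_le_max (abs_clip_le hR0 _) (abs_clip_le hR0 _)
  obtain ⟨X, hX0, hX⟩ := exists_solution_of_lipschitz_of_bounded (V := fun t x => A t (κ x))
    (K := ⟨L, hL0⟩) (N := L * R)
    (fun t ht => LipschitzWith.of_dist_le_mul fun x y => by
      rw [dist_eq_norm, ← map_sub]
      refine ((A t).le_opNorm _).trans ?_
      have := hκ1.dist_le_mul x y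
      rw [dist_eq_norm, NNReal.coe_one, one_mul] at this
      exact mul_le_mul (hL t ht) this (norm_nonneg _) hL0)
    (fun x => hA.clm_apply continuousOn_const)
    (fun t ht x => ((A t).le_opNorm _).trans
      (mul_le_mul (hL t ht) (hκR x) (norm_nonneg _) hL0)) e
  have hb : ∀ t ∈ Icc (0 : ℝ) 1, ‖X t‖ ≤ R := fun t ht => by
    have h := norm_le_gronwallBound_of_norm_deriv_right_le (δ := ‖e‖) (K := L) (ε := 0)
      (fun t ht => (hX t ht).continuousWithinAt)
      (fun t ht => hasDerivWithinAt_Ici_of_Icc ht (hX t (Ico_subset_Icc_self ht)))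
      (by rw [hX0]) (fun t ht => by
        rw [add_zero]
        exact ((A t).le_opNorm _).trans
          (mul_le_mul (hL t (Ico_subset_Icc_self ht)) (hκn _) (norm_nonneg _) hL0)) t ht
    rw [gronwallBound_ε0, sub_zero] at h
    refine h.trans ?_
    have : L * t ≤ L := by nlinarith [ht.2]
    rw [hR]
    show ‖e‖ * Real.exp (L * t) ≤ _
    gcongr
  refine ⟨X, hX0, fun t ht => ?_⟩
  have h1 := hb t ht
  simp only [Prod.norm_def, Real.norm_eq_abs, max_le_iff, abs_le] at h1
  have : κ (X t) = X t := by
    simp only [hκ]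
    rw [clip_of_mem h1.1, clip_of_mem h1.2]
  simpa only [this] using hX t ht

theorem gronwallBound_zero_one_le {K ε : ℝ} (hK : 0 ≤ K) (hε : 0 ≤ ε) :
    gronwallBound 0 K ε 1 ≤ ε * Real.exp K := by
  rcases hK.eq_or_lt with rfl | hK
  · simp [gronwallBound_K0]
  · rw [gronwallBound_of_K_ne_0 hK.ne']
    have h := Real.add_one_le_exp (-K)
    have h2 : Real.exp (-K) * Real.exp K = 1 := by rw [← Real.exp_add]; simp
    have h3 : Real.exp K - 1 ≤ K * Real.exp K := by nlinarith [Real.exp_pos K]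
    simp only [zero_mul, zero_add, mul_one]
    rw [div_mul_eq_mul_div, div_le_iff₀ hK]
    nlinarith

/-- Differentiable dependence of a solution at time `1` on its initial value, along a line of
initial values. -/
theorem hasDerivAt_solution_initial {V : ℝ → E → E} {V' : ℝ → E → E →L[ℝ] E} {U : Set E}
    (hUo : IsOpen U) (hUc : Convex ℝ U)
    (hV : ∀ t ∈ Icc (0 : ℝ) 1, ∀ z ∈ U, HasFDerivAt (V t) (V' t z) z)
    (hV' : ContinuousOn (fun q : ℝ × E => V' q.1 q.2) (Icc 0 1 ×ˢ U))
    {L : ℝ} (hL : ∀ t ∈ Icc (0 : ℝ) 1, ∀ z ∈ U, ‖V' t z‖ ≤ L)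
    {γ : ℝ → ℝ → E} {s₀ : ℝ} {e c : E}
    (hγ0 : ∀ᶠ s in 𝓝 s₀, γ s 0 = c + (s - s₀) • e)
    (hγ : ∀ᶠ s in 𝓝 s₀, ∀ t ∈ Icc (0 : ℝ) 1,
      γ s t ∈ U ∧ HasDerivWithinAt (γ s) (V t (γ s t)) (Icc 0 1) t)
    {X : ℝ → E} (hX0 : X 0 = e)
    (hX : ∀ t ∈ Icc (0 : ℝ) 1, HasDerivWithinAt X (V' t (γ s₀ t) (X t)) (Icc 0 1) t) :
    HasDerivAt (fun s => γ s 1) (X 1) s₀ := by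
  have h1 : (1 : ℝ) ∈ Icc (0 : ℝ) 1 := by simp
  have hs₀ := hγ.self_of_nhds
  have hL0 : 0 ≤ L := (norm_nonneg _).trans (hL 1 h1 _ (hs₀ 1 h1).1)
  set K : NNReal := ⟨L, hL0⟩ with hK
  have hlip : ∀ t ∈ Icc (0 : ℝ) 1, LipschitzOnWith K (V t) U := fun t ht =>
    hUc.lipschitzOnWith_of_nnnorm_hasFDerivWithin_le
      (fun z hz => (hV t ht z hz).hasFDerivWithinAt) (fun z hz => hL t ht z hz)
  have hcont : ContinuousOn (γ s₀) (Icc 0 1) := fun t ht => (hs₀ t ht).2.continuousWithinAt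
  -- the derivative is uniformly close to its value along the reference curve
  have hunif : ∀ η > 0, ∃ δ > 0, ∀ t ∈ Icc (0 : ℝ) 1, ∀ z, ‖z - γ s₀ t‖ < δ →
      z ∈ U ∧ ‖V' t z - V' t (γ s₀ t)‖ ≤ η := by
    intro η hη
    have hev : ∀ t ∈ Icc (0 : ℝ) 1, ∀ᶠ q : ℝ × E in 𝓝[Icc 0 1] t ×ˢ 𝓝 (0 : E),
        γ s₀ q.1 + q.2 ∈ U ∧ ‖V' q.1 (γ s₀ q.1 + q.2) - V' q.1 (γ s₀ q.1)‖ ≤ η := by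
      intro t ht
      have hT : Tendsto (fun q : ℝ × E => γ s₀ q.1 + q.2) (𝓝[Icc 0 1] t ×ˢ 𝓝 (0 : E))
          (𝓝 (γ s₀ t)) := by
        have := ((hcont t ht).tendsto.comp tendsto_fst).add
          (tendsto_snd (f := 𝓝[Icc (0 : ℝ) 1] t) (g := 𝓝 (0 : E)))
        simpa using this
      have hT0 : Tendsto (fun q : ℝ × E => γ s₀ q.1) (𝓝[Icc 0 1] t ×ˢ 𝓝 (0 : E))
          (𝓝 (γ s₀ t)) := (hcont t ht).tendsto.comp tendsto_fst
      have hfst : Tendsto (fun q : ℝ × E => q.1) (𝓝[Icc 0 1] t ×ˢ 𝓝 (0 : E))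
          (𝓝[Icc 0 1] t) := tendsto_fst
      have hUn : U ∈ 𝓝 (γ s₀ t) := hUo.mem_nhds (hs₀ t ht).1
      have hcV := hV' (t, γ s₀ t) ⟨ht, (hs₀ t ht).1⟩
      have key : ∀ (m : ℝ × E → E), Tendsto m (𝓝[Icc 0 1] t ×ˢ 𝓝 (0 : E)) (𝓝 (γ s₀ t)) →
          Tendsto (fun q => V' q.1 (m q)) (𝓝[Icc 0 1] t ×ˢ 𝓝 (0 : E)) (𝓝 (V' t (γ s₀ t))) := by
        intro m hm
        refine hcV.tendsto.comp (f := fun q => (q.1, m q)) ?_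
        rw [nhdsWithin_prod_eq]
        refine hfst.prodMk (tendsto_nhdsWithin_iff.2 ⟨hm, hm.eventually_mem hUn⟩)
      have hd := ((key _ hT).sub (key _ hT0)).norm
      rw [sub_self, norm_zero] at hd
      filter_upwards [hT.eventually_mem hUn, hd.eventually_lt_const hη] with q h1 h2
      exact ⟨h1, h2.le⟩
    -- Compactness of `[0, 1]` turns the local statements at each time into a single neighbourhood
    -- of `0`.
    have hall : ∀ᶠ ζ in 𝓝 (0 : E), ∀ t ∈ Icc (0 : ℝ) 1,
        γ s₀ t + ζ ∈ U ∧ ‖V' t (γ s₀ t + ζ) - V' t (γ s₀ t)‖ ≤ η := by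
      refine isCompact_Icc.induction_on (p := fun S => ∀ᶠ ζ in 𝓝 (0 : E), ∀ t ∈ S,
        γ s₀ t + ζ ∈ U ∧ ‖V' t (γ s₀ t + ζ) - V' t (γ s₀ t)‖ ≤ η) (by simp)
        (fun S T hST h => h.mono fun ζ hζ t ht => hζ t (hST ht)) (fun S T hS hT => ?_)
        (fun t ht => ?_)
      · filter_upwards [hS, hT] with ζ h1 h2 t ht
        exact ht.elim (h1 t) (h2 t)
      · obtain ⟨pa, hpa, pb, hpb, h⟩ := eventually_prod_iff.1 (hev t ht)
        exact ⟨{x | pa x}, hpa, hpb.mono fun ζ hζ x hx => h hx hζ⟩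
    obtain ⟨δ, hδ, h⟩ := Metric.eventually_nhds_iff.1 hall
    refine ⟨δ, hδ, fun t ht z hz => ?_⟩
    have := h (y := z - γ s₀ t) (by rwa [dist_zero_right]) t ht
    rwa [add_sub_cancel] at this
  rw [hasDerivAt_iff_isLittleO, Asymptotics.isLittleO_iff]
  intro ρ hρ
  -- Two factors `exp L` will appear, one from the distance between the curves and one from
  -- Gronwall's inequality for the error. The `+ 1` guards against `e = 0`.
  obtain ⟨δ, hδ, hclose⟩ := hunif (ρ / (‖e‖ + 1) * Real.exp (-(2 * L)))
    (by positivity)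
  have hsmall : ∀ᶠ s in 𝓝 s₀, |s - s₀| * ‖e‖ * Real.exp L < δ := by
    have : Tendsto (fun s => |s - s₀| * ‖e‖ * Real.exp L) (𝓝 s₀)
        (𝓝 (|s₀ - s₀| * ‖e‖ * Real.exp L)) :=
      Continuous.tendsto (by fun_prop) _
    rw [sub_self, abs_zero, zero_mul, zero_mul] at this
    exact this.eventually_lt_const hδ
  have hz₀ := hγ0.self_of_nhds
  filter_upwards [hγ, hsmall, hγ0] with s hs hsm hz
  have hdist : ∀ t ∈ Icc (0 : ℝ) 1, ‖γ s t - γ s₀ t‖ ≤ |s - s₀| * ‖e‖ * Real.exp L := by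
    intro t ht
    have h := dist_le_of_trajectories_ODE_of_mem (v := V) (s := fun _ => U) (K := K)
      (δ := |s - s₀| * ‖e‖) (fun t ht => hlip t (Ico_subset_Icc_self ht))
      (fun t ht => (hs t ht).2.continuousWithinAt)
      (fun t ht => hasDerivWithinAt_Ici_of_Icc ht (hs t (Ico_subset_Icc_self ht)).2)
      (fun t ht => (hs t (Ico_subset_Icc_self ht)).1) hcont
      (fun t ht => hasDerivWithinAt_Ici_of_Icc ht (hs₀ t (Ico_subset_Icc_self ht)).2)
      (fun t ht => (hs₀ t (Ico_subset_Icc_self ht)).1)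
      (by simp [hz, hz₀, dist_eq_norm, norm_smul]) t ht
    rw [dist_eq_norm, sub_zero] at h
    refine h.trans ?_
    have : (K : ℝ) * t ≤ L := by
      show L * t ≤ L
      nlinarith [ht.2]
    gcongr
  set η := ρ / (‖e‖ + 1) * Real.exp (-(2 * L)) with hη
  have hη0 : 0 ≤ η := by positivity
  have hD : ∀ t ∈ Icc (0 : ℝ) 1,
      HasDerivWithinAt (fun t => γ s t - γ s₀ t - (s - s₀) • X t)
        (V t (γ s t) - V t (γ s₀ t) - (s - s₀) • V' t (γ s₀ t) (X t)) (Icc 0 1) t := fun t ht =>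
    ((hs t ht).2.sub (hs₀ t ht).2).sub ((hX t ht).const_smul (s - s₀))
  have h := norm_le_gronwallBound_of_norm_deriv_right_le (δ := 0) (K := L)
    (ε := η * (|s - s₀| * ‖e‖ * Real.exp L))
    (fun t ht => (hD t ht).continuousWithinAt)
    (fun t ht => hasDerivWithinAt_Ici_of_Icc ht (hD t (Ico_subset_Icc_self ht)))
    (by simp [hz, hz₀, hX0]) (fun t ht => by
      have ht' := Ico_subset_Icc_self ht
      have hlt := (hdist t ht').trans_lt hsm
      have hmv := (convex_ball (γ s₀ t) δ).norm_image_sub_le_of_norm_hasFDerivWithin_le'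
        (f := V t) (f' := V' t) (φ := V' t (γ s₀ t)) (C := η) (x := γ s₀ t) (y := γ s t)
        (fun z hz => (hV t ht' z
          (hclose t ht' z (by rwa [mem_ball_iff_norm] at hz)).1).hasFDerivWithinAt)
        (fun z hz => (hclose t ht' z (by rwa [mem_ball_iff_norm] at hz)).2)
        (Metric.mem_ball_self hδ) (by rwa [mem_ball_iff_norm])
      -- The error satisfies the linear equation up to the Taylor remainder of `V t`, which the mean
      -- value inequality bounds by `η` times the distance.
      have hsplit : V t (γ s t) - V t (γ s₀ t) - (s - s₀) • V' t (γ s₀ t) (X t)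
          = V' t (γ s₀ t) (γ s t - γ s₀ t - (s - s₀) • X t)
            + (V t (γ s t) - V t (γ s₀ t) - V' t (γ s₀ t) (γ s t - γ s₀ t)) := by
        simp only [map_sub, map_smul]
        abel
      rw [hsplit]
      refine (norm_add_le _ _).trans (add_le_add ?_ (hmv.trans ?_))
      · exact ((V' t (γ s₀ t)).le_opNorm _).trans
          (mul_le_mul_of_nonneg_right (hL t ht' _ (hs₀ t ht').1) (norm_nonneg _))
      · exact mul_le_mul_of_nonneg_left (hdist t ht') hη0) 1 h1
  rw [sub_zero] at h
  refine h.trans ((gronwallBound_zero_one_le hL0 (by positivity)).trans ?_)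
  have hexp : Real.exp (-(2 * L)) * (Real.exp L * Real.exp L) = 1 := by
    rw [← Real.exp_add, ← Real.exp_add]
    simp [two_mul]
  have he : ρ / (‖e‖ + 1) * ‖e‖ ≤ ρ := by
    rw [div_mul_eq_mul_div, div_le_iff₀ (by positivity)]
    nlinarith [norm_nonneg e]
  calc η * (|s - s₀| * ‖e‖ * Real.exp L) * Real.exp L
      = (ρ / (‖e‖ + 1) * ‖e‖) * |s - s₀| * (Real.exp (-(2 * L)) * (Real.exp L * Real.exp L)) := by
        rw [hη]; ring
    _ = (ρ / (‖e‖ + 1) * ‖e‖) * |s - s₀| := by rw [hexp, mul_one]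
    _ ≤ ρ * ‖s - s₀‖ := by
        rw [Real.norm_eq_abs]
        exact mul_le_mul_of_nonneg_right he (abs_nonneg _)

/-- A perturbation of `u' = b v`, `v' = 2 u` in which the possibly large coefficient `b` has,
up to a small error, a small primitive `β`: the solution starting at `(1, 0)` stays close to
`(1, 2t)` in the second component. -/
theorem abs_sub_two_le_of_small_primitive {u v a b c d e β c₂ : ℝ → ℝ} {η : ℝ} (hη0 : 0 ≤ η)
    (hη1 : η ≤ 1)
    (hu : ∀ t ∈ Icc (0 : ℝ) 1,
      HasDerivWithinAt u (a t * u t + (b t + c t) * v t) (Icc 0 1) t)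
    (hv : ∀ t ∈ Icc (0 : ℝ) 1,
      HasDerivWithinAt v ((2 + d t) * u t + e t * v t) (Icc 0 1) t)
    (hβ : ∀ t ∈ Icc (0 : ℝ) 1, HasDerivWithinAt β (b t + c₂ t) (Icc 0 1) t)
    (ha : ∀ t ∈ Icc (0 : ℝ) 1, |a t| ≤ η) (hc : ∀ t ∈ Icc (0 : ℝ) 1, |c t| ≤ η)
    (hd : ∀ t ∈ Icc (0 : ℝ) 1, |d t| ≤ η) (he : ∀ t ∈ Icc (0 : ℝ) 1, |e t| ≤ η)
    (hβη : ∀ t ∈ Icc (0 : ℝ) 1, |β t| ≤ η) (hc₂ : ∀ t ∈ Icc (0 : ℝ) 1, |c₂ t| ≤ η)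
    (hu0 : u 0 = 1) (hv0 : v 0 = 0) :
    |v 1 - 2| ≤ 12 * Real.exp 16 * η := by
  -- In `(u - β v)'` the large term `b v` cancels, leaving only terms with a factor of size `η`.
  set Y : ℝ → ℝ × ℝ := fun t => (u t - β t * v t, v t) with hY
  set Y' : ℝ → ℝ × ℝ := fun t =>
    (a t * u t + (b t + c t) * v t
      - ((b t + c₂ t) * v t + β t * ((2 + d t) * u t + e t * v t)),
      (2 + d t) * u t + e t * v t) with hY'
  have hYd : ∀ t ∈ Icc (0 : ℝ) 1, HasDerivWithinAt Y (Y' t) (Icc 0 1) t := fun t ht =>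
    ((hu t ht).sub ((hβ t ht).mul (hv t ht))).prodMk (hv t ht)
  have hnear : ∀ t ∈ Icc (0 : ℝ) 1, ‖Y' t - (0, 2 * (Y t).1)‖ ≤ 12 * η * ‖Y t‖ := by
    intro t ht
    have hw : |u t - β t * v t| ≤ ‖Y t‖ := le_max_left _ _
    have hv' : |v t| ≤ ‖Y t‖ := le_max_right _ _
    set n := ‖Y t‖
    have hn : 0 ≤ n := norm_nonneg _
    have hu' : |u t| ≤ 2 * n := by
      have h1 : |u t| ≤ |u t - β t * v t| + |β t * v t| := by
        simpa using abs_add_le (u t - β t * v t) (β t * v t)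
      have h2 : |β t * v t| ≤ 1 * n := by
        rw [abs_mul]
        exact mul_le_mul ((hβη t ht).trans hη1) hv' (abs_nonneg _) zero_le_one
      linarith
    have m : ∀ {x y z : ℝ}, |x| ≤ η → |y| ≤ z → |x * y| ≤ η * z := fun {x y z} hx hy => by
      rw [abs_mul]
      exact mul_le_mul hx hy (abs_nonneg _) hη0
    have m1 := m (ha t ht) hu'
    have m2 := m (hc t ht) hv'
    have m3 := m (hc₂ t ht) hv'
    have m4 := m (hd t ht) hu'
    have m5 := m (he t ht) hv'
    have m6 := m (hβη t ht) hv'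
    have m7 : |β t * ((2 + d t) * u t + e t * v t)| ≤ η * (7 * n) := by
      -- As `|d|, |e| ≤ 1` and `|u| ≤ 2 n`, the second factor is at most `3 · 2 n + n = 7 n`.
      refine m (hβη t ht) ?_
      have e1 : η * (2 * n) ≤ 1 * (2 * n) := by gcongr
      have e2 : η * n ≤ 1 * n := by gcongr
      rw [abs_le] at *
      constructor <;> nlinarith
    rw [Prod.norm_def, max_le_iff]
    simp only [hY', hY, Prod.fst_sub, Prod.snd_sub, Real.norm_eq_abs, sub_zero]
    have hηn : 0 ≤ η * n := by positivity
    rw [abs_le] at *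
    rw [abs_le]
    refine ⟨⟨?_, ?_⟩, ?_, ?_⟩ <;> linarith
  -- The rate `14` is `2` for the unperturbed field plus `12 η ≤ 12`.
  have hgrow : ∀ t ∈ Icc (0 : ℝ) 1, ‖Y t‖ ≤ Real.exp 14 := by
    intro t ht
    have h := norm_le_gronwallBound_of_norm_deriv_right_le (f := Y) (δ := 1) (K := 14) (ε := 0)
      (fun t ht => (hYd t ht).continuousWithinAt)
      (fun t ht => hasDerivWithinAt_Ici_of_Icc ht (hYd t (Ico_subset_Icc_self ht)))
      (by simp [hY, hu0, hv0]) (fun t ht => by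
        have h1 := hnear t (Ico_subset_Icc_self ht)
        have h2 : ‖((0 : ℝ), 2 * (Y t).1)‖ ≤ 2 * ‖Y t‖ := by
          simp [Prod.norm_def]
        have h3 := norm_add_le (Y' t - (0, 2 * (Y t).1)) (0, 2 * (Y t).1)
        rw [sub_add_cancel] at h3
        have h4 : 12 * η * ‖Y t‖ ≤ 12 * 1 * ‖Y t‖ := by gcongr
        linarith) t ht
    rw [gronwallBound_ε0, sub_zero, one_mul] at h
    exact h.trans (Real.exp_le_exp.2 (by linarith [ht.2]))
  have hexact : ∀ t : ℝ, HasDerivWithinAt (fun t : ℝ => ((1 : ℝ), 2 * t)) (0, 2) (Ici t) t :=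
    fun t => (hasDerivWithinAt_const t _ (1 : ℝ)).prodMk
      (by simpa using (hasDerivWithinAt_id t _).const_mul (2 : ℝ))
  -- `Y` is an approximate solution of `w' = 0`, `v' = 2 w`, whose exact solution from `(1, 0)` is
  -- `(1, 2t)`. The Lipschitz constant `2` turns `exp 14` into `exp 16`.
  have h := dist_le_of_approx_trajectories_ODE (v := fun _ y => ((0 : ℝ), 2 * y.1)) (K := 2)
    (f := Y) (g := fun t => (1, 2 * t)) (f' := Y') (g' := fun _ => (0, 2))
    (εf := 12 * η * Real.exp 14) (εg := 0) (δ := 0) (a := 0) (b := 1)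
    (fun t => LipschitzWith.of_dist_le_mul fun x y => by
      simp only [dist_eq_norm, Prod.norm_def (x := (_, _) - (_, _)), Prod.fst_sub, Prod.snd_sub,
        sub_self, norm_zero, ← mul_sub, norm_mul]
      simp)
    (fun t ht => (hYd t ht).continuousWithinAt)
    (fun t ht => hasDerivWithinAt_Ici_of_Icc ht (hYd t (Ico_subset_Icc_self ht)))
    (fun t ht => by
      have ht' := Ico_subset_Icc_self ht
      rw [dist_eq_norm]
      exact (hnear t ht').trans (mul_le_mul_of_nonneg_left (hgrow t ht') (by positivity)))
    (by fun_prop) (fun t _ => hexact t) (by simp) (by simp [hY, hu0, hv0]) 1 (by simp)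
  rw [add_zero, sub_zero] at h
  have h2 := h.trans (gronwallBound_zero_one_le (by simp) (by positivity))
  have h3 : |v 1 - 2| ≤ dist (Y 1) (1, 2 * 1) := by
    rw [dist_eq_norm]
    simp [hY, Prod.norm_def]
  refine h3.trans (h2.trans (le_of_eq ?_))
  have : Real.exp 16 = Real.exp 14 * Real.exp 2 := by rw [← Real.exp_add]; norm_num
  rw [this]
  push_cast
  ring

end ODE
-- Perturbed twist fields: trajectories, variational equation, limit of the derivative
/-- `γ` solves `z' = V(t, z)` on `[0, 1]` within the half-plane `R < z.1`, and starts at `z₀`. -/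
structure IsTrajectory (V : ℝ → ℝ × ℝ → ℝ × ℝ) (R : ℝ) (z₀ : ℝ × ℝ) (γ : ℝ → ℝ × ℝ) : Prop where
  init : γ 0 = z₀
  mem : ∀ t ∈ Icc (0 : ℝ) 1, R < (γ t).1
  ode : ∀ t ∈ Icc (0 : ℝ) 1, HasDerivWithinAt γ (V t (γ t)) (Icc 0 1) t

/-- `f` is of class `C^{0,1}` on `R < z.1` with spatial derivative `f'`, and both decay like the
inverse square root of `z.1`. -/
structure IsDecaying (R K : ℝ) (f : ℝ → ℝ × ℝ → ℝ) (f' : ℝ → ℝ × ℝ → ℝ × ℝ →L[ℝ] ℝ) :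
    Prop where
  hasFDerivAt : ∀ t ∈ Icc (0 : ℝ) 1, ∀ z : ℝ × ℝ, R < z.1 → HasFDerivAt (f t) (f' t z) z
  continuousOn_fderiv : ContinuousOn (fun q : ℝ × (ℝ × ℝ) => f' q.1 q.2)
    (Icc 0 1 ×ˢ {z | R < z.1})
  continuousOn : ∀ z : ℝ × ℝ, R < z.1 → ContinuousOn (fun t => f t z) (Icc 0 1)
  bound : ∀ t ∈ Icc (0 : ℝ) 1, ∀ z : ℝ × ℝ, R < z.1 → |f t z| ≤ K / √z.1
  bound_fderiv : ∀ t ∈ Icc (0 : ℝ) 1, ∀ z : ℝ × ℝ, R < z.1 → ‖f' t z‖ ≤ K / √z.1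

theorem IsDecaying.add {R K₁ K₂ : ℝ} {f g : ℝ → ℝ × ℝ → ℝ} {f' g' : ℝ → ℝ × ℝ → ℝ × ℝ →L[ℝ] ℝ}
    (hf : IsDecaying R K₁ f f') (hg : IsDecaying R K₂ g g') :
    IsDecaying R (K₁ + K₂) (fun t z => f t z + g t z) (fun t z => f' t z + g' t z) where
  hasFDerivAt t ht z hz := (hf.hasFDerivAt t ht z hz).add (hg.hasFDerivAt t ht z hz)
  continuousOn_fderiv := hf.continuousOn_fderiv.add hg.continuousOn_fderiv
  continuousOn z hz := (hf.continuousOn z hz).add (hg.continuousOn z hz)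
  bound t ht z hz := by
    rw [add_div]
    exact (abs_add_le _ _).trans (add_le_add (hf.bound t ht z hz) (hg.bound t ht z hz))
  bound_fderiv t ht z hz := by
    rw [add_div]
    exact (norm_add_le _ _).trans
      (add_le_add (hf.bound_fderiv t ht z hz) (hg.bound_fderiv t ht z hz))

theorem IsDecaying.mono {R K₁ K₂ : ℝ} {f : ℝ → ℝ × ℝ → ℝ} {f' : ℝ → ℝ × ℝ → ℝ × ℝ →L[ℝ] ℝ}
    (hf : IsDecaying R K₁ f f') (h : K₁ ≤ K₂) : IsDecaying R K₂ f f' where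
  hasFDerivAt := hf.hasFDerivAt
  continuousOn_fderiv := hf.continuousOn_fderiv
  continuousOn := hf.continuousOn
  bound t ht z hz := (hf.bound t ht z hz).trans (by gcongr)
  bound_fderiv t ht z hz := (hf.bound_fderiv t ht z hz).trans (by gcongr)

/-- A `C¹` function of time and angle is bounded on `[0, 1]`, together with its derivative. -/
theorem exists_bound_of_periodic {B : ℝ × ℝ → ℝ} (hB : ContDiff ℝ 1 B)
    (hper : ∀ t θ, B (t, θ + 2 * Real.pi) = B (t, θ)) :
    ∃ M, ∀ t ∈ Icc (0 : ℝ) 1, ∀ θ, |B (t, θ)| ≤ M ∧ ‖fderiv ℝ B (t, θ)‖ ≤ M := by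
  have hc : IsCompact (Icc (0 : ℝ) 1 ×ˢ Icc (0 : ℝ) (2 * Real.pi)) :=
    isCompact_Icc.prod isCompact_Icc
  obtain ⟨M₁, h₁⟩ := hc.exists_bound_of_continuousOn hB.continuous.continuousOn
  obtain ⟨M₂, h₂⟩ := hc.exists_bound_of_continuousOn
    (hB.continuous_fderiv (by simp)).continuousOn
  have hper' : ∀ t θ, fderiv ℝ B (t, θ + 2 * Real.pi) = fderiv ℝ B (t, θ) := fun t θ => by
    have h := fderiv_comp_add_right (𝕜 := ℝ) (f := B) (x := (t, θ)) (0, 2 * Real.pi)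
    have h' : (fun x : ℝ × ℝ => B (x + (0, 2 * Real.pi))) = B := by
      funext x
      exact (congrArg B (Prod.ext (by simp) (by simp))).trans (hper x.1 x.2)
    rw [h'] at h
    simpa using h.symm
  refine ⟨max M₁ M₂, fun t ht θ => ?_⟩
  have p1 : Function.Periodic (fun θ => (B (t, θ), fderiv ℝ B (t, θ))) (2 * Real.pi) :=
    fun θ => Prod.ext (hper t θ) (hper' t θ)
  obtain ⟨ϑ, hϑ, he⟩ := p1.exists_mem_Ico₀ Real.two_pi_pos θ
  simp only [Prod.mk.injEq] at he
  rw [he.1, he.2]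
  have hm : (t, ϑ) ∈ Icc (0 : ℝ) 1 ×ˢ Icc (0 : ℝ) (2 * Real.pi) := ⟨ht, Ico_subset_Icc_self hϑ⟩
  exact ⟨(h₁ _ hm).trans (le_max_left _ _), (h₂ _ hm).trans (le_max_right _ _)⟩

/-- The planar field `(B(t, θ) + f(t, r, θ), 2 r + g(t, r, θ))`. -/
def twistField (B : ℝ × ℝ → ℝ) (f g : ℝ → ℝ × ℝ → ℝ) (t : ℝ) (z : ℝ × ℝ) : ℝ × ℝ :=
  (B (t, z.2) + f t z, 2 * z.1 + g t z)

/-- The spatial derivative of `twistField`. -/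
noncomputable def twistFieldDeriv (B : ℝ × ℝ → ℝ) (f' g' : ℝ → ℝ × ℝ → ℝ × ℝ →L[ℝ] ℝ) (t : ℝ)
    (z : ℝ × ℝ) : ℝ × ℝ →L[ℝ] ℝ × ℝ :=
  ((fderiv ℝ B (t, z.2)).comp ((0 : ℝ × ℝ →L[ℝ] ℝ).prod (ContinuousLinearMap.snd ℝ ℝ ℝ))
    + f' t z).prod ((2 : ℝ) • ContinuousLinearMap.fst ℝ ℝ ℝ + g' t z)

theorem twistFieldDeriv_apply (B : ℝ × ℝ → ℝ) (f' g' : ℝ → ℝ × ℝ → ℝ × ℝ →L[ℝ] ℝ) (t : ℝ)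
    (z x : ℝ × ℝ) : twistFieldDeriv B f' g' t z x
      = (fderiv ℝ B (t, z.2) (0, x.2) + f' t z x, 2 * x.1 + g' t z x) := by
  simp [twistFieldDeriv]

theorem apply_eq_of_prod (φ : ℝ × ℝ →L[ℝ] ℝ) (x y : ℝ) :
    φ (x, y) = φ (1, 0) * x + φ (0, 1) * y := by
  have : ((x, y) : ℝ × ℝ) = x • (1, 0) + y • (0, 1) := by simp
  rw [this, map_add, map_smul, map_smul, smul_eq_mul, smul_eq_mul]
  ring

theorem abs_apply_le_of_norm_le {φ : ℝ × ℝ →L[ℝ] ℝ} {C : ℝ} (h : ‖φ‖ ≤ C) :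
    |φ (1, 0)| ≤ C ∧ |φ (0, 1)| ≤ C := by
  constructor
  · simpa [Prod.norm_def] using (φ.le_of_opNorm_le h (1, 0))
  · simpa [Prod.norm_def] using (φ.le_of_opNorm_le h (0, 1))

section Twist

variable {R K : ℝ} {B : ℝ × ℝ → ℝ} {f g : ℝ → ℝ × ℝ → ℝ} {f' g' : ℝ → ℝ × ℝ → ℝ × ℝ →L[ℝ] ℝ}

theorem isOpen_halfPlane (R : ℝ) : IsOpen {z : ℝ × ℝ | R < z.1} :=
  isOpen_lt continuous_const continuous_fst

theorem convex_halfPlane (R : ℝ) : Convex ℝ {z : ℝ × ℝ | R < z.1} :=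
  convex_halfSpace_gt (f := fun z : ℝ × ℝ => z.1) ⟨fun _ _ => rfl, fun _ _ => rfl⟩ R

theorem hasFDerivAt_twistField (hB : ContDiff ℝ 1 B) (hf : IsDecaying R K f f')
    (hg : IsDecaying R K g g') {t : ℝ} (ht : t ∈ Icc (0 : ℝ) 1) {z : ℝ × ℝ} (hz : R < z.1) :
    HasFDerivAt (twistField B f g t) (twistFieldDeriv B f' g' t z) z := by
  have h1 : HasFDerivAt (fun z : ℝ × ℝ => (t, z.2))
      ((0 : ℝ × ℝ →L[ℝ] ℝ).prod (ContinuousLinearMap.snd ℝ ℝ ℝ)) z :=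
    (hasFDerivAt_const t z).prodMk hasFDerivAt_snd
  have h2 : HasFDerivAt B (fderiv ℝ B (t, z.2)) (t, z.2) :=
    (hB.differentiable (by simp) _).hasFDerivAt
  exact ((h2.comp z h1).add (hf.hasFDerivAt t ht z hz)).prodMk
    ((hasFDerivAt_fst.const_mul 2).add (hg.hasFDerivAt t ht z hz))

theorem continuousOn_twistFieldDeriv (hB : ContDiff ℝ 1 B) (hf : IsDecaying R K f f')
    (hg : IsDecaying R K g g') :
    ContinuousOn (fun q : ℝ × (ℝ × ℝ) => twistFieldDeriv B f' g' q.1 q.2)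
      (Icc 0 1 ×ˢ {z | R < z.1}) := by
  have hDB : Continuous (fderiv ℝ B) := hB.continuous_fderiv (by simp)
  have h1 : Continuous fun q : ℝ × (ℝ × ℝ) => (fderiv ℝ B (q.1, q.2.2)).comp
      ((0 : ℝ × ℝ →L[ℝ] ℝ).prod (ContinuousLinearMap.snd ℝ ℝ ℝ)) :=
    (hDB.comp (by fun_prop)).clm_comp continuous_const
  exact (ContinuousLinearMap.prodₗᵢ ℝ).continuous.comp_continuousOn
    ((h1.continuousOn.add hf.continuousOn_fderiv).prodMk
      (continuousOn_const.add hg.continuousOn_fderiv))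

/-- The bounds on `[0, 1]` that the estimates along the trajectories of a `twistField` use. -/
structure TwistBounds (R K M : ℝ) (B : ℝ × ℝ → ℝ) (f g : ℝ → ℝ × ℝ → ℝ)
    (f' g' : ℝ → ℝ × ℝ → ℝ × ℝ →L[ℝ] ℝ) : Prop where
  pos : 0 < R
  contDiff : ContDiff ℝ 1 B
  bound : ∀ t ∈ Icc (0 : ℝ) 1, ∀ θ, |B (t, θ)| ≤ M ∧ ‖fderiv ℝ B (t, θ)‖ ≤ M
  left : IsDecaying R K f f'
  right : IsDecaying R K g g'

namespace TwistBounds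

variable {M : ℝ}

theorem div_sqrt_le (hR : 0 < R) (hK : 0 ≤ K) {r : ℝ} (hr : R < r) : K / √r ≤ K / √R := by
  have := Real.sqrt_pos.2 hR
  gcongr

theorem nonneg (h : TwistBounds R K M B f g f' g') : 0 ≤ K ∧ 0 ≤ M := by
  constructor
  · have h1 := (abs_nonneg _).trans (h.left.bound 0 (by simp) (R + 1, 0) (by simp))
    have h2 : 0 < √(R + 1) := Real.sqrt_pos.2 (by linarith [h.pos])
    by_contra hK
    exact absurd h1 (not_le.2 (div_neg_of_neg_of_pos (not_le.1 hK) h2))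
  · exact (abs_nonneg _).trans (h.bound 0 (by simp) 0).1

theorem fst_le (h : TwistBounds R K M B f g f' g') {t : ℝ} (ht : t ∈ Icc (0 : ℝ) 1) {z : ℝ × ℝ}
    (hz : R < z.1) : ‖(twistField B f g t z).1‖ ≤ M + K / √R :=
  (abs_add_le _ _).trans (add_le_add (h.bound t ht _).1
    ((h.left.bound t ht z hz).trans (div_sqrt_le h.pos h.nonneg.1 hz)))

theorem norm_deriv_le (h : TwistBounds R K M B f g f' g') {t : ℝ} (ht : t ∈ Icc (0 : ℝ) 1)
    {z : ℝ × ℝ} (hz : R < z.1) :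
    ‖twistFieldDeriv B f' g' t z‖ ≤ M + 2 + K / √R := by
  have hK := div_sqrt_le h.pos h.nonneg.1 hz
  have hM := h.nonneg.2
  have hK0 : 0 ≤ K / √R := div_nonneg h.nonneg.1 (Real.sqrt_nonneg _)
  refine ContinuousLinearMap.opNorm_le_bound _ (by positivity) fun x => ?_
  have hx2 : ‖((0 : ℝ), x.2)‖ ≤ ‖x‖ := by simp [Prod.norm_def]
  have hx1 : |2 * x.1| ≤ 2 * ‖x‖ := by
    rw [abs_mul, abs_two]
    exact mul_le_mul_of_nonneg_left (norm_fst_le x) zero_le_two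
  have e1 : |fderiv ℝ B (t, z.2) (0, x.2)| ≤ M * ‖x‖ :=
    ((fderiv ℝ B (t, z.2)).le_of_opNorm_le (h.bound t ht z.2).2 _).trans
      (mul_le_mul_of_nonneg_left hx2 hM)
  have e2 : |f' t z x| ≤ K / √R * ‖x‖ :=
    (f' t z).le_of_opNorm_le ((h.left.bound_fderiv t ht z hz).trans hK) x
  have e3 : |g' t z x| ≤ K / √R * ‖x‖ :=
    (g' t z).le_of_opNorm_le ((h.right.bound_fderiv t ht z hz).trans hK) x
  have hMx : 0 ≤ M * ‖x‖ := by positivity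
  rw [twistFieldDeriv_apply, Prod.norm_def, max_le_iff]
  constructor
  · refine (abs_add_le _ _).trans ?_
    nlinarith [norm_nonneg x]
  · refine (abs_add_le _ _).trans ?_
    nlinarith [norm_nonneg x]

theorem lipschitzOnWith (h : TwistBounds R K M B f g f' g') {t : ℝ} (ht : t ∈ Icc (0 : ℝ) 1) :
    LipschitzOnWith (M + 2 + K / √R).toNNReal (twistField B f g t) {z | R < z.1} :=
  (convex_halfPlane R).lipschitzOnWith_of_nnnorm_hasFDerivWithin_le
    (fun _ hz => (hasFDerivAt_twistField h.contDiff h.left h.right ht hz).hasFDerivWithinAt)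
    (fun _ hz => NNReal.coe_le_coe.1 ((h.norm_deriv_le ht hz).trans (Real.le_coe_toNNReal _)))

theorem eqOn (h : TwistBounds R K M B f g f' g') {z₀ : ℝ × ℝ} {γ δ : ℝ → ℝ × ℝ}
    (hγ : IsTrajectory (twistField B f g) R z₀ γ) (hδ : IsTrajectory (twistField B f g) R z₀ δ) :
    EqOn γ δ (Icc 0 1) :=
  ODE_solution_unique_of_mem_Icc_right
    (fun _ ht => h.lipschitzOnWith (Ico_subset_Icc_self ht))
    (fun t ht => (hγ.ode t ht).continuousWithinAt)
    (fun t ht => hasDerivWithinAt_Ici_of_Icc ht (hγ.ode t (Ico_subset_Icc_self ht)))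
    (fun t ht => hγ.mem t (Ico_subset_Icc_self ht))
    (fun t ht => (hδ.ode t ht).continuousWithinAt)
    (fun t ht => hasDerivWithinAt_Ici_of_Icc ht (hδ.ode t (Ico_subset_Icc_self ht)))
    (fun t ht => hδ.mem t (Ico_subset_Icc_self ht)) (hγ.init.trans hδ.init.symm)

theorem abs_sub_le_of_deriv {r r' : ℝ → ℝ} {N : ℝ} (hN : 0 ≤ N)
    (hr : ∀ t ∈ Icc (0 : ℝ) 1, HasDerivWithinAt r (r' t) (Icc 0 1) t)
    (hb : ∀ t ∈ Icc (0 : ℝ) 1, ‖r' t‖ ≤ N) {t : ℝ} (ht : t ∈ Icc (0 : ℝ) 1) :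
    |r t - r 0| ≤ N := by
  refine ((convex_Icc (0 : ℝ) 1).norm_image_sub_le_of_norm_hasDerivWithin_le hr hb
    (by simp) ht).trans ?_
  rw [sub_zero, Real.norm_eq_abs, abs_of_nonneg ht.1]
  nlinarith [ht.2]

theorem abs_fst_sub_le (h : TwistBounds R K M B f g f' g') {z₀ : ℝ × ℝ} {γ : ℝ → ℝ × ℝ}
    (hγ : IsTrajectory (twistField B f g) R z₀ γ) {t : ℝ} (ht : t ∈ Icc (0 : ℝ) 1) :
    |(γ t).1 - z₀.1| ≤ M + K / √R := by
  have hN : 0 ≤ M + K / √R := add_nonneg h.nonneg.2 (div_nonneg h.nonneg.1 (Real.sqrt_nonneg _))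
  have := abs_sub_le_of_deriv (r := fun t => (γ t).1) hN
    (fun t ht => hasDerivWithinAt_fst (hγ.ode t ht))
    (fun t ht => h.fst_le ht (hγ.mem t ht)) ht
  rwa [hγ.init] at this

/-- Only the radius needs truncation: the field is unbounded in `r` but not in `θ`. The bound `N` on
`r'` keeps the radius of the truncated solution within `N` of its start, where the truncation is the
identity, and above `R`. -/
theorem exists_trajectory (h : TwistBounds R K M B f g f' g') {z₀ : ℝ × ℝ}
    (hz₀ : R + (M + K / √R) < z₀.1) : ∃ γ, IsTrajectory (twistField B f g) R z₀ γ := by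
  set N := M + K / √R with hNdef
  have hN : 0 ≤ N := add_nonneg h.nonneg.2 (div_nonneg h.nonneg.1 (Real.sqrt_nonneg _))
  set κ : ℝ × ℝ → ℝ × ℝ := fun z => (clip (z₀.1 - N) (z₀.1 + N) z.1, z.2) with hκ
  have hκ1 : LipschitzWith 1 κ := by
    have h1 := (lipschitzWith_clip (z₀.1 - N) (z₀.1 + N)).comp
      (LipschitzWith.prod_fst (α := ℝ) (β := ℝ))
    simpa using h1.prodMk (LipschitzWith.prod_snd (α := ℝ) (β := ℝ))
  have hcl := fun x => clip_mem (by linarith : z₀.1 - N ≤ z₀.1 + N) x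
  have hκR : ∀ z, R < (κ z).1 := fun z => lt_of_lt_of_le (by linarith) (hcl z.1).1
  obtain ⟨γ, hγ0, hγ⟩ := exists_solution_of_lipschitz_of_bounded
    (V := fun t z => twistField B f g t (κ z)) (K := (M + 2 + K / √R).toNNReal)
    (N := max N (2 * (z₀.1 + N) + K / √R))
    (fun t ht => by
      have := (h.lipschitzOnWith ht).comp (hκ1.lipschitzOnWith (s := univ)) (fun z _ => hκR z)
      rw [mul_one] at this
      exact lipschitzOnWith_univ.1 this)
    (fun z => ((h.contDiff.continuous.comp (by fun_prop)).continuousOn.add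
        (h.left.continuousOn _ (hκR z))).prodMk
      (continuousOn_const.add (h.right.continuousOn _ (hκR z))))
    (fun t ht z => by
      refine max_le_max (h.fst_le ht (hκR z)) ((abs_add_le _ _).trans (add_le_add ?_
        ((h.right.bound t ht _ (hκR z)).trans (div_sqrt_le h.pos h.nonneg.1 (hκR z)))))
      have hp : 0 < (κ z).1 := h.pos.trans (hκR z)
      rw [abs_of_nonneg (by linarith)]
      linarith [(hcl z.1).2]) z₀
  have hb : ∀ t ∈ Icc (0 : ℝ) 1, κ (γ t) = γ t := fun t ht => by
    have := abs_sub_le_of_deriv (r := fun t => (γ t).1) hN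
      (fun t ht => hasDerivWithinAt_fst (hγ t ht))
      (fun t ht => h.fst_le ht (hκR _)) ht
    rw [hγ0, abs_le] at this
    simp only [hκ]
    rw [clip_of_mem ⟨by linarith, by linarith⟩]
  refine ⟨γ, hγ0, fun t ht => ?_, fun t ht => ?_⟩
  · rw [← hb t ht]
    exact hκR _
  · have := hγ t ht
    rwa [hb t ht] at this

end TwistBounds

end Twist
end Vortex

namespace Vortex
namespace TwistBounds

variable {R K M : ℝ} {B : ℝ × ℝ → ℝ} {f g : ℝ → ℝ × ℝ → ℝ} {f' g' : ℝ → ℝ × ℝ → ℝ × ℝ →L[ℝ] ℝ}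

theorem exists_hasDerivAt (h : TwistBounds R K M B f g f' g') {a θ₀ r₀ : ℝ}
    {Γ : ℝ → ℝ → ℝ × ℝ}
    (hΓ : ∀ ρ > a, IsTrajectory (twistField B f g) R (ρ, θ₀) (Γ ρ)) (hr₀ : a < r₀) :
    ∃ X : ℝ → ℝ × ℝ, X 0 = (1, 0) ∧
      (∀ t ∈ Icc (0 : ℝ) 1,
        HasDerivWithinAt X (twistFieldDeriv B f' g' t (Γ r₀ t) (X t)) (Icc 0 1) t) ∧
      HasDerivAt (fun ρ => Γ ρ 1) (X 1) r₀ := by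
  have hcV := continuousOn_twistFieldDeriv h.contDiff h.left h.right
  have hc : ContinuousOn (fun t => twistFieldDeriv B f' g' t (Γ r₀ t)) (Icc 0 1) :=
    hcV.comp (f := fun t => (t, Γ r₀ t))
      (continuousOn_id.prodMk fun t ht => ((hΓ r₀ hr₀).ode t ht).continuousWithinAt)
      (fun t ht => ⟨ht, (hΓ r₀ hr₀).mem t ht⟩)
  obtain ⟨X, hX0, hX⟩ := exists_solution_linear hc (1, 0)
  refine ⟨X, hX0, hX, ?_⟩
  refine hasDerivAt_solution_initial (c := (r₀, θ₀)) (isOpen_halfPlane R) (convex_halfPlane R)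
    (fun t ht z hz => hasFDerivAt_twistField h.contDiff h.left h.right ht hz) hcV
    (fun t ht z hz => h.norm_deriv_le ht hz) ?_ ?_ hX0 hX
  · filter_upwards [lt_mem_nhds hr₀] with ρ hρ
    simp [(hΓ ρ hρ).init]
  · filter_upwards [lt_mem_nhds hr₀] with ρ hρ t ht
    exact ⟨(hΓ ρ hρ).mem t ht, (hΓ ρ hρ).ode t ht⟩

/-- Along the orbit `θ' = 2 r + g`, so dividing `B` by `2 r` normalizes the angular part of its
derivative to `∂_θ B`. The rest carries a factor `1 / (2 r)`. -/
theorem hasDerivWithinAt_primitive (h : TwistBounds R K M B f g f' g') {z₀ : ℝ × ℝ}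
    {γ : ℝ → ℝ × ℝ} (hγ : IsTrajectory (twistField B f g) R z₀ γ) {t : ℝ}
    (ht : t ∈ Icc (0 : ℝ) 1) :
    HasDerivWithinAt (fun t => B (t, (γ t).2) / (2 * (γ t).1))
      (fderiv ℝ B (t, (γ t).2) (0, 1)
        + (fderiv ℝ B (t, (γ t).2) (1, 0) + fderiv ℝ B (t, (γ t).2) (0, 1) * g t (γ t)
          - B (t, (γ t).2) * (B (t, (γ t).2) + f t (γ t)) / (γ t).1) / (2 * (γ t).1))
      (Icc 0 1) t := by
  have hpos : (γ t).1 ≠ 0 := (h.pos.trans (hγ.mem t ht)).ne'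
  have hB : HasFDerivAt B (fderiv ℝ B (t, (γ t).2)) (t, (γ t).2) :=
    (h.contDiff.differentiable (by simp) _).hasFDerivAt
  have h1 : HasDerivWithinAt (fun t => (t, (γ t).2)) (1, (twistField B f g t (γ t)).2)
      (Icc 0 1) t := (hasDerivWithinAt_id t _).prodMk (hasDerivWithinAt_snd (hγ.ode t ht))
  have h2 := (hB.comp_hasDerivWithinAt t h1).div
    ((hasDerivWithinAt_fst (hγ.ode t ht)).const_mul 2)
    (mul_ne_zero two_ne_zero hpos)
  refine h2.congr_deriv ?_
  rw [apply_eq_of_prod]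
  simp only [twistField, Function.comp]
  field_simp
  ring

/-- The averaging estimate applied to the variational equation, with `b = ∂_θ B` and `β = B / (2
r)`. The constant in `hη` dominates all numerators: `K` for the derivatives of `f` and `g`, `M` for
`β`, and `M + M K + M (M + K)` for the error in `β'`. -/
theorem abs_variation_sub_le (h : TwistBounds R K M B f g f' g') {z₀ : ℝ × ℝ}
    {γ X : ℝ → ℝ × ℝ} (hγ : IsTrajectory (twistField B f g) R z₀ γ) (hX0 : X 0 = (1, 0))
    (hX : ∀ t ∈ Icc (0 : ℝ) 1,
      HasDerivWithinAt X (twistFieldDeriv B f' g' t (γ t) (X t)) (Icc 0 1) t)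
    {r η : ℝ} (hr : 1 ≤ r) (hγr : ∀ t ∈ Icc (0 : ℝ) 1, r ≤ (γ t).1)
    (hη : (K + M + M * K + M * (M + K)) / √r ≤ η) (hη1 : η ≤ 1) :
    |(X 1).2 - 2| ≤ 12 * Real.exp 16 * η := by
  obtain ⟨hK, hM⟩ := h.nonneg
  have hr1 : 1 ≤ √r := Real.one_le_sqrt.2 hr
  have hr0 : 0 < √r := by linarith
  have hη0 : 0 ≤ η := le_trans (by positivity) hη
  have hle : K / √r ≤ η := le_trans (by
    gcongr
    nlinarith [mul_nonneg hM hK, mul_nonneg hM hM]) hη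
  have hKs : ∀ t ∈ Icc (0 : ℝ) 1, K / √(γ t).1 ≤ K / √r := fun t ht => by
    gcongr
    exact hγr t ht
  have hKs' : K / √r ≤ K := div_le_self hK hr1
  have hsr : √r ≤ r := by nlinarith [Real.sq_sqrt (by linarith : (0 : ℝ) ≤ r)]
  have hdiv : ∀ t ∈ Icc (0 : ℝ) 1, ∀ {x C : ℝ}, |x| ≤ C → C ≤ K + M + M * K + M * (M + K) →
      |x / (2 * (γ t).1)| ≤ η := by
    intro t ht x C hx hC
    have h1 := hγr t ht
    rw [abs_div, abs_of_pos (by linarith : 0 < 2 * (γ t).1)]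
    refine le_trans ?_ hη
    have : √r ≤ 2 * (γ t).1 := by linarith
    gcongr
    exact hx.trans hC
  have hu : ∀ t ∈ Icc (0 : ℝ) 1, HasDerivWithinAt (fun t => (X t).1)
      (f' t (γ t) (1, 0) * (X t).1
        + (fderiv ℝ B (t, (γ t).2) (0, 1) + f' t (γ t) (0, 1)) * (X t).2) (Icc 0 1) t := by
    intro t ht
    refine (hasDerivWithinAt_fst (hX t ht)).congr_deriv ?_
    rw [twistFieldDeriv_apply, apply_eq_of_prod (f' t (γ t)) (X t).1 (X t).2,
      apply_eq_of_prod (fderiv ℝ B (t, (γ t).2)) 0 (X t).2]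
    ring
  have hv : ∀ t ∈ Icc (0 : ℝ) 1, HasDerivWithinAt (fun t => (X t).2)
      ((2 + g' t (γ t) (1, 0)) * (X t).1 + g' t (γ t) (0, 1) * (X t).2) (Icc 0 1) t := by
    intro t ht
    refine (hasDerivWithinAt_snd (hX t ht)).congr_deriv ?_
    rw [twistFieldDeriv_apply, apply_eq_of_prod (g' t (γ t)) (X t).1 (X t).2]
    ring
  have hf := fun t ht => abs_apply_le_of_norm_le
    (((h.left.bound_fderiv t ht _ (hγ.mem t ht)).trans (hKs t ht)).trans hle)
  have hg := fun t ht => abs_apply_le_of_norm_le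
    (((h.right.bound_fderiv t ht _ (hγ.mem t ht)).trans (hKs t ht)).trans hle)
  refine abs_sub_two_le_of_small_primitive hη0 hη1 hu hv
    (fun t ht => h.hasDerivWithinAt_primitive hγ ht)
    (fun t ht => (hf t ht).1) (fun t ht => (hf t ht).2)
    (fun t ht => (hg t ht).1) (fun t ht => (hg t ht).2)
    (fun t ht => hdiv t ht (h.bound t ht _).1 ?_) (fun t ht => hdiv t ht ?_ le_rfl)
    (by simp [hX0]) (by simp [hX0])
  · nlinarith [mul_nonneg hM hK, mul_nonneg hM hM]
  · obtain ⟨hB, hDB⟩ := h.bound t ht (γ t).2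
    obtain ⟨h1, h2⟩ := abs_apply_le_of_norm_le hDB
    have hft := ((h.left.bound t ht _ (hγ.mem t ht)).trans (hKs t ht)).trans hKs'
    have hgt := ((h.right.bound t ht _ (hγ.mem t ht)).trans (hKs t ht)).trans hKs'
    have h3 : |fderiv ℝ B (t, (γ t).2) (0, 1) * g t (γ t)| ≤ M * K := by
      rw [abs_mul]
      exact mul_le_mul h2 hgt (abs_nonneg _) hM
    have h4 : |B (t, (γ t).2) * (B (t, (γ t).2) + f t (γ t)) / (γ t).1| ≤ M * (M + K) := by
      have h5 := hγr t ht
      rw [abs_div, abs_of_pos (by linarith : 0 < (γ t).1), abs_mul]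
      refine (div_le_self (by positivity) (by linarith)).trans ?_
      exact mul_le_mul hB ((abs_add_le _ _).trans (add_le_add hB hft)) (abs_nonneg _) hM
    refine (abs_sub _ _).trans ?_
    have := abs_add_le (fderiv ℝ B (t, (γ t).2) (1, 0))
      (fderiv ℝ B (t, (γ t).2) (0, 1) * g t (γ t))
    linarith

/-- The angular component of the time-`1` map is differentiable in the initial radius, with
derivative close to `2` for large radii. -/
theorem exists_derivative_near_two (h : TwistBounds R K M B f g f' g') {η : ℝ} (hη : 0 < η) :
    ∃ R₁, ∀ a θ₀ : ℝ, ∀ Γ : ℝ → ℝ → ℝ × ℝ,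
      (∀ ρ > a, IsTrajectory (twistField B f g) R (ρ, θ₀) (Γ ρ)) →
      ∀ r₀ > a, R₁ < r₀ → |deriv (fun ρ => (Γ ρ 1).2) r₀ - 2| < η := by
  set N := M + K / √R with hN
  set C := K + M + M * K + M * (M + K) with hC
  have hT : Tendsto (fun r : ℝ => C / √(r - N)) atTop (𝓝 0) :=
    (Real.tendsto_sqrt_atTop.comp (tendsto_atTop_add_const_right _ (-N) tendsto_id)).const_div_atTop
      C
  -- The denominator is twice the constant of the estimate, so the final bound is `η / 2`, hence
  -- strict.
  set η' := min 1 (η / (24 * Real.exp 16)) with hη'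
  have hη'0 : 0 < η' := by positivity
  -- The orbit stays above `r₀ - N`, which therefore serves as its lower radius and must be at least
  -- `1`.
  obtain ⟨R₁, hR₁⟩ := eventually_atTop.1
    ((hT.eventually_le_const hη'0).and (eventually_ge_atTop (N + 1)))
  refine ⟨R₁, fun a θ₀ Γ hΓ r₀ hr₀ hr₁ => ?_⟩
  obtain ⟨X, hX0, hX, hd⟩ := h.exists_hasDerivAt hΓ hr₀
  obtain ⟨h1, h2⟩ := hR₁ r₀ hr₁.le
  rw [(hasDerivAt_snd hd).deriv]
  have := h.abs_variation_sub_le (hΓ r₀ hr₀) hX0 hX (r := r₀ - N) (by linarith)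
    (fun t ht => by
      have := abs_le.1 (h.abs_fst_sub_le (hΓ r₀ hr₀) ht)
      simp only at this
      linarith) h1 (min_le_left _ _)
  refine this.trans_lt ?_
  have h3 : 12 * Real.exp 16 * η' ≤ 12 * Real.exp 16 * (η / (24 * Real.exp 16)) := by
    gcongr
    exact min_le_right _ _
  refine h3.trans_lt ?_
  have : 12 * Real.exp 16 * (η / (24 * Real.exp 16)) = η / 2 := by
    field_simp
    norm_num
  linarith

end TwistBounds
-- The change of variables and its derivative
/-- The change of variables `(r, θ) ↦ (cos θ / √(2r), - sin θ / √(2r))`. -/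
noncomputable def polar (z : ℝ × ℝ) : ℝ × ℝ :=
  (Real.cos z.2 / √(2 * z.1), -Real.sin z.2 / √(2 * z.1))

/-- The clockwise rotation by a right angle. -/
def rot : ℝ × ℝ →L[ℝ] ℝ × ℝ :=
  (ContinuousLinearMap.snd ℝ ℝ ℝ).prod (-ContinuousLinearMap.fst ℝ ℝ ℝ)

/-- The derivative of `polar`. -/
noncomputable def polarDeriv (z : ℝ × ℝ) : ℝ × ℝ →L[ℝ] ℝ × ℝ :=
  (ContinuousLinearMap.snd ℝ ℝ ℝ).smulRight (rot (polar z))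
    - (1 / (2 * z.1)) • (ContinuousLinearMap.fst ℝ ℝ ℝ).smulRight (polar z)

theorem norm_rot_le : ‖rot‖ ≤ 1 :=
  ContinuousLinearMap.opNorm_le_bound _ zero_le_one fun x => by
    simpa [rot, Prod.norm_def] using le_total |x.2| |x.1|

theorem hasFDerivAt_polar {z : ℝ × ℝ} (hz : 0 < z.1) : HasFDerivAt polar (polarDeriv z) z := by
  have h0 : (0 : ℝ) < 2 * z.1 := by linarith
  have hs : HasFDerivAt (fun z : ℝ × ℝ => √(2 * z.1))
      ((1 / (2 * √(2 * z.1))) • ((2 : ℝ) • ContinuousLinearMap.fst ℝ ℝ ℝ)) z :=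
    (hasFDerivAt_fst.const_mul 2).sqrt h0.ne'
  have hsp : √(2 * z.1) ≠ 0 := (Real.sqrt_pos.2 h0).ne'
  have hi := (hasDerivAt_inv hsp).comp_hasFDerivAt z hs
  have hsnd : HasFDerivAt (Prod.snd : ℝ × ℝ → ℝ) (ContinuousLinearMap.snd ℝ ℝ ℝ) z :=
    hasFDerivAt_snd
  have hc : HasFDerivAt (fun z : ℝ × ℝ => Real.cos z.2) _ z :=
    (Real.hasDerivAt_cos z.2).comp_hasFDerivAt z hsnd
  have hn : HasFDerivAt (fun z : ℝ × ℝ => -Real.sin z.2) _ z :=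
    ((Real.hasDerivAt_sin z.2).comp_hasFDerivAt z hsnd).neg
  have h := (hc.mul hi).prodMk (hn.mul hi)
  have hsq : (√2 * √z.1) ^ 2 = 2 * z.1 := by
    rw [mul_pow, Real.sq_sqrt zero_le_two, Real.sq_sqrt hz.le]
  refine (h.congr_fderiv ?_).congr_of_eventuallyEq (Eventually.of_forall fun w => ?_)
  · refine ContinuousLinearMap.ext fun x => Prod.ext ?_ ?_
    · simp [polarDeriv, rot, polar]
      rw [hsq]
      field_simp
      ring
    · simp [polarDeriv, rot, polar]
      rw [hsq]
      field_simp
      ring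
  · simp [polar, div_eq_mul_inv]

theorem continuousOn_polar : ContinuousOn polar {z : ℝ × ℝ | 0 < z.1} := fun _ hz =>
  (hasFDerivAt_polar hz).continuousAt.continuousWithinAt

theorem continuousOn_polarDeriv : ContinuousOn polarDeriv {z : ℝ × ℝ | 0 < z.1} := by
  have h1 : ContinuousOn (fun z : ℝ × ℝ => 1 / (2 * z.1)) {z : ℝ × ℝ | 0 < z.1} :=
    continuousOn_const.div (by fun_prop) fun z hz => (mul_pos two_pos hz).ne'
  have h2 : ∀ l : ℝ × ℝ →L[ℝ] ℝ, Continuous fun w : ℝ × ℝ => l.smulRight w := fun l =>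
    (ContinuousLinearMap.smulRightL ℝ (ℝ × ℝ) (ℝ × ℝ) l).continuous
  exact ((h2 _).comp_continuousOn (rot.continuous.comp_continuousOn continuousOn_polar)).sub
    (h1.smul ((h2 _).comp_continuousOn continuousOn_polar))

theorem abs_polar_le {z : ℝ × ℝ} :
    |(polar z).1| ≤ 1 / √(2 * z.1) ∧ |(polar z).2| ≤ 1 / √(2 * z.1) := by
  have hs := Real.sqrt_nonneg (2 * z.1)
  simp only [polar, abs_div, abs_neg, abs_of_nonneg hs]
  exact ⟨by gcongr; exact Real.abs_cos_le_one _, by gcongr; exact Real.abs_sin_le_one _⟩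

theorem norm_polar_le (z : ℝ × ℝ) : ‖polar z‖ ≤ 1 / √(2 * z.1) :=
  max_le abs_polar_le.1 abs_polar_le.2

/-- The angular derivative of `polar` is a rotation of `polar`, and the radial one is `-polar / (2
r)`. Differentiating thus costs no power of `r` away from `r = 0`. -/
theorem norm_polarDeriv_le {R : ℝ} (hR : 0 < R) {z : ℝ × ℝ} (hz : R < z.1) :
    ‖polarDeriv z‖ ≤ (1 + 1 / (2 * R)) * (1 / √(2 * z.1)) := by
  have hz0 : 0 < z.1 := hR.trans hz
  have hp := norm_polar_le z
  have hr : ‖rot (polar z)‖ ≤ 1 / √(2 * z.1) := by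
    have := rot.le_of_opNorm_le norm_rot_le (polar z)
    linarith
  have h1 : ‖(1 : ℝ) / (2 * z.1)‖ ≤ 1 / (2 * R) := by
    rw [Real.norm_eq_abs, abs_of_pos (by positivity)]
    gcongr
  refine (norm_sub_le _ _).trans ?_
  rw [norm_smul, ContinuousLinearMap.norm_smulRight_apply, ContinuousLinearMap.norm_smulRight_apply,
    add_mul]
  have hs := ContinuousLinearMap.norm_snd_le (𝕜 := ℝ) (E := ℝ) (F := ℝ)
  have hf := ContinuousLinearMap.norm_fst_le (𝕜 := ℝ) (E := ℝ) (F := ℝ)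
  refine add_le_add (mul_le_mul hs hr (norm_nonneg _) zero_le_one)
    (mul_le_mul h1 ?_ (by positivity) (by positivity))
  calc _ ≤ 1 * (1 / √(2 * z.1)) := mul_le_mul hf hp (norm_nonneg _) zero_le_one
    _ = _ := one_mul _

theorem rStar_pos {ε : ℝ} (hε : 0 < ε) : 0 < rStar ε := by
  unfold rStar
  positivity

theorem isOpen_disk (ε : ℝ) : IsOpen (disk ε) :=
  isOpen_lt (f := fun z : ℝ × ℝ => z.1 ^ 2 + z.2 ^ 2) (by fun_prop) continuous_const

theorem polar_mem_disk {ε : ℝ} (hε : 0 < ε) {z : ℝ × ℝ} (hz : rStar ε < z.1) :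
    polar z ∈ disk ε := by
  have h0 : 0 < z.1 := (rStar_pos hε).trans hz
  have h2 : (0 : ℝ) ≤ 2 * z.1 := by linarith
  simp only [disk, polar, mem_ofPred_eq, div_pow, neg_sq, Real.sq_sqrt h2]
  rw [← add_div, Real.cos_sq_add_sin_sq, div_lt_iff₀ (by linarith)]
  rw [rStar, div_lt_iff₀ (by positivity)] at hz
  linarith

theorem hasDerivAt_polar_angle {r : ℝ} (hr : 0 < r) (θ : ℝ) :
    HasDerivAt (fun ϑ => polar (r, ϑ)) (rot (polar (r, θ))) θ := by
  have := (hasFDerivAt_polar (z := (r, θ)) hr).comp_hasDerivAt θ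
    ((hasDerivAt_const θ r).prodMk (hasDerivAt_id θ))
  simpa [polarDeriv, Function.comp_def] using this

theorem hasDerivAt_polar_radius {r : ℝ} (hr : 0 < r) (θ : ℝ) :
    HasDerivAt (fun ρ => polar (ρ, θ)) (-((1 / (2 * r)) • polar (r, θ))) r := by
  have := (hasFDerivAt_polar (z := (r, θ)) hr).comp_hasDerivAt r
    ((hasDerivAt_id r).prodMk (hasDerivAt_const r θ))
  simpa [polarDeriv, Function.comp_def] using this

/-! ### Decay of the terms produced by a flat remainder -/

/-- Functions of class `C^{0,2}` on the disk whose first and second spatial derivatives have the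
size of those of a function that vanishes to fifth order at the origin. -/
structure IsFlatRemainder (ε C : ℝ) (q : ℝ → ℝ × ℝ → ℝ) : Prop where
  contDiffOn : ∀ t, ContDiffOn ℝ 2 (q t) (disk ε)
  continuousOn_fderiv : ContinuousOn (fun x : ℝ × (ℝ × ℝ) => fderiv ℝ (q x.1) x.2)
    (univ ×ˢ disk ε)
  continuousOn_fderiv_fderiv :
    ContinuousOn (fun x : ℝ × (ℝ × ℝ) => fderiv ℝ (fderiv ℝ (q x.1)) x.2) (univ ×ˢ disk ε)
  bound : ∀ t, ∀ w ∈ disk ε, ∀ s, |w.1| ≤ s → |w.2| ≤ s → ‖fderiv ℝ (q t) w‖ ≤ C * s ^ 4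
  bound₂ : ∀ t, ∀ w ∈ disk ε, ∀ s, |w.1| ≤ s → |w.2| ≤ s →
    ‖fderiv ℝ (fderiv ℝ (q t)) w‖ ≤ C * s ^ 3

namespace IsFlatRemainder

variable {ε C : ℝ} {q : ℝ → ℝ × ℝ → ℝ}

theorem hasFDerivAt (h : IsFlatRemainder ε C q) (t : ℝ) {w : ℝ × ℝ} (hw : w ∈ disk ε) :
    HasFDerivAt (q t) (fderiv ℝ (q t) w) w :=
  (((h.contDiffOn t).contDiffAt ((isOpen_disk ε).mem_nhds hw)).differentiableAt
    (by simp)).hasFDerivAt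

theorem hasFDerivAt_fderiv (h : IsFlatRemainder ε C q) (t : ℝ) {w : ℝ × ℝ} (hw : w ∈ disk ε) :
    HasFDerivAt (fderiv ℝ (q t)) (fderiv ℝ (fderiv ℝ (q t)) w) w :=
  ((((h.contDiffOn t).contDiffAt ((isOpen_disk ε).mem_nhds hw)).fderiv_right
    (m := 1) (by norm_num)).differentiableAt (by simp)).hasFDerivAt

theorem hasDerivAt_pert_angle (h : IsFlatRemainder ε C q) (hε : 0 < ε) (t : ℝ) {r : ℝ}
    (hr : rStar ε < r) (θ : ℝ) : HasDerivAt (fun ϑ => pert q t r ϑ)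
      (fderiv ℝ (q t) (polar (r, θ)) (rot (polar (r, θ)))) θ :=
  (h.hasFDerivAt t (polar_mem_disk hε (z := (r, θ)) hr)).comp_hasDerivAt θ
    (hasDerivAt_polar_angle ((rStar_pos hε).trans hr) θ)

theorem hasDerivAt_pert_radius (h : IsFlatRemainder ε C q) (hε : 0 < ε) (t : ℝ) {r : ℝ}
    (hr : rStar ε < r) (θ : ℝ) : HasDerivAt (fun ρ => pert q t ρ θ)
      (-(1 / (2 * r) * fderiv ℝ (q t) (polar (r, θ)) (polar (r, θ)))) r := by
  refine ((h.hasFDerivAt t (polar_mem_disk hε (z := (r, θ)) hr)).comp_hasDerivAt r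
    (hasDerivAt_polar_radius ((rStar_pos hε).trans hr) θ)).congr_deriv ?_
  rw [map_neg, map_smul, smul_eq_mul]

/-- The terms of the regularized field that come from a flat remainder decay. -/
theorem isDecaying (h : IsFlatRemainder ε C q) (hε : 0 < ε) {A : ℝ × ℝ →L[ℝ] ℝ × ℝ}
    (hA : ‖A‖ ≤ 1) {m m' : ℝ → ℝ} {μ : ℝ} (hm : ∀ r, HasDerivAt m (m' r) r)
    (hmc' : Continuous m') (hμ : ∀ r, rStar ε < r → |m r| ≤ μ * r ^ 2)
    (hμ' : ∀ r, rStar ε < r → |m' r| ≤ μ * r ^ 2) :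
    ∃ K f', IsDecaying (rStar ε) K
      (fun t z => m z.1 * fderiv ℝ (q t) (polar z) (A (polar z))) f' := by
  have hR := rStar_pos hε
  set c := 1 + 1 / (2 * rStar ε) with hc
  have hc0 : 0 ≤ c := by positivity
  have hC0 : 0 ≤ C := by
    have h1 : ((0 : ℝ), (0 : ℝ)) ∈ disk ε := by simp [disk]; positivity
    have := (norm_nonneg _).trans (h.bound 0 _ h1 1 (by simp) (by simp))
    simpa using this
  have hμ0 : 0 ≤ μ := by
    have h1 := (abs_nonneg _).trans (hμ (rStar ε + 1) (by linarith))
    have h2 : 0 < (rStar ε + 1) ^ 2 := by positivity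
    exact nonneg_of_mul_nonneg_left h1 h2
  -- The derivative of `z ↦ D(q t)(polar z)(A (polar z))`, by the chain and product rules.
  set H : ℝ → ℝ × ℝ → ℝ × ℝ →L[ℝ] ℝ := fun t z =>
    (fderiv ℝ (q t) (polar z)).comp (A.comp (polarDeriv z))
      + ((fderiv ℝ (fderiv ℝ (q t)) (polar z)).comp (polarDeriv z)).flip (A (polar z)) with hH
  have hcm : Continuous m := continuous_iff_continuousAt.2 fun r => (hm r).continuousAt
  have hpol : ContinuousOn (fun x : ℝ × (ℝ × ℝ) => polar x.2)
      (Icc 0 1 ×ˢ {z : ℝ × ℝ | rStar ε < z.1}) :=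
    continuousOn_polar.comp continuousOn_snd fun x hx => hR.trans hx.2
  have hpolD : ContinuousOn (fun x : ℝ × (ℝ × ℝ) => polarDeriv x.2)
      (Icc 0 1 ×ˢ {z : ℝ × ℝ | rStar ε < z.1}) :=
    continuousOn_polarDeriv.comp continuousOn_snd fun x hx => hR.trans hx.2
  have hpair : ContinuousOn (fun x : ℝ × (ℝ × ℝ) => (x.1, polar x.2))
      (Icc 0 1 ×ˢ {z : ℝ × ℝ | rStar ε < z.1}) := continuousOn_fst.prodMk hpol
  have hmaps : MapsTo (fun x : ℝ × (ℝ × ℝ) => (x.1, polar x.2))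
      (Icc 0 1 ×ˢ {z : ℝ × ℝ | rStar ε < z.1}) (univ ×ˢ disk ε) :=
    fun x hx => ⟨mem_univ _, polar_mem_disk hε hx.2⟩
  have hD1 := h.continuousOn_fderiv.comp hpair hmaps
  have hD2 := h.continuousOn_fderiv_fderiv.comp hpair hmaps
  have hApol := A.continuous.comp_continuousOn hpol
  have hval : ContinuousOn (fun x : ℝ × (ℝ × ℝ) =>
      fderiv ℝ (q x.1) (polar x.2) (A (polar x.2))) (Icc 0 1 ×ˢ {z : ℝ × ℝ | rStar ε < z.1}) :=
    hD1.clm_apply hApol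
  have hHc : ContinuousOn (fun x : ℝ × (ℝ × ℝ) => H x.1 x.2)
      (Icc 0 1 ×ˢ {z : ℝ × ℝ | rStar ε < z.1}) := by
    refine (hD1.clm_comp (continuousOn_const.clm_comp hpolD)).add ?_
    have := (ContinuousLinearMap.flipₗᵢ ℝ (ℝ × ℝ) (ℝ × ℝ) ℝ).continuous.comp_continuousOn
      (hD2.clm_comp hpolD)
    exact this.clm_apply hApol
  have hs : ∀ z : ℝ × ℝ, rStar ε < z.1 → 1 / √(2 * z.1) ≤ 1 / √z.1 := fun z hz => by
    have h0 : 0 < z.1 := hR.trans hz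
    have := Real.sqrt_pos.2 h0
    gcongr
    linarith
  have hs4 : ∀ z : ℝ × ℝ, rStar ε < z.1 → z.1 ^ 2 * (1 / √(2 * z.1)) ^ 4 ≤ 1 := fun z hz => by
    have h0 : 0 < z.1 := hR.trans hz
    have h1 : √(2 * z.1) ^ 4 = (2 * z.1) ^ 2 := by
      rw [show 4 = 2 * 2 by norm_num, pow_mul, Real.sq_sqrt (by linarith)]
    rw [div_pow, h1, one_pow, mul_one_div, div_le_one (by positivity)]
    nlinarith
  have hApn : ∀ z, ‖A (polar z)‖ ≤ 1 / √(2 * z.1) := fun z => by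
    have := A.le_of_opNorm_le hA (polar z)
    linarith [norm_polar_le z]
  have hvb : ∀ t, ∀ z : ℝ × ℝ, rStar ε < z.1 → |fderiv ℝ (q t) (polar z) (A (polar z))|
      ≤ C * (1 / √(2 * z.1)) ^ 4 * (1 / √(2 * z.1)) := fun t z hz =>
    ((fderiv ℝ (q t) (polar z)).le_of_opNorm_le (h.bound t _ (polar_mem_disk hε hz) _
      abs_polar_le.1 abs_polar_le.2) _).trans
      (mul_le_mul_of_nonneg_left (hApn z) (by positivity))
  have hHb : ∀ t, ∀ z : ℝ × ℝ, rStar ε < z.1 → ‖H t z‖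
      ≤ 2 * c * C * (1 / √(2 * z.1)) ^ 4 * (1 / √(2 * z.1)) := fun t z hz => by
    have h1 := h.bound t _ (polar_mem_disk hε hz) _ abs_polar_le.1 abs_polar_le.2
    have h2 := h.bound₂ t _ (polar_mem_disk hε hz) _ abs_polar_le.1 abs_polar_le.2
    have h3 := norm_polarDeriv_le hR hz
    have h4 := hApn z
    set s := 1 / √(2 * z.1)
    have hs0 : 0 ≤ s := by positivity
    refine (norm_add_le _ _).trans ?_
    have e1 : ‖(fderiv ℝ (q t) (polar z)).comp (A.comp (polarDeriv z))‖
        ≤ C * s ^ 4 * (1 * (c * s)) := by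
      refine (ContinuousLinearMap.opNorm_comp_le _ _).trans (mul_le_mul h1
        ((ContinuousLinearMap.opNorm_comp_le _ _).trans
          (mul_le_mul hA h3 (norm_nonneg _) zero_le_one)) (norm_nonneg _) (by positivity))
    have e2 : ‖((fderiv ℝ (fderiv ℝ (q t)) (polar z)).comp (polarDeriv z)).flip (A (polar z))‖
        ≤ C * s ^ 3 * (c * s) * s := by
      refine (ContinuousLinearMap.le_opNorm _ _).trans ?_
      rw [ContinuousLinearMap.opNorm_flip]
      exact mul_le_mul ((ContinuousLinearMap.opNorm_comp_le _ _).trans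
        (mul_le_mul h2 h3 (norm_nonneg _) (by positivity))) h4 (norm_nonneg _) (by positivity)
    calc _ ≤ _ := add_le_add e1 e2
      _ = _ := by ring
  -- Of the five factors `1 / √(2 r)`, four absorb the weight `r²` and the fifth gives the decay.
  have hfin : ∀ z : ℝ × ℝ, rStar ε < z.1 → ∀ {x y D : ℝ}, 0 ≤ D → 0 ≤ y → x ≤ μ * z.1 ^ 2 →
      y ≤ D * (1 / √(2 * z.1)) ^ 4 * (1 / √(2 * z.1)) → x * y ≤ μ * D / √z.1 := by
    intro z hz x y D hD hy0 hx hy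
    have h4 := hs4 z hz
    calc x * y ≤ (μ * z.1 ^ 2) * (D * (1 / √(2 * z.1)) ^ 4 * (1 / √(2 * z.1))) :=
          mul_le_mul hx hy hy0 (by positivity)
      _ = μ * D * (z.1 ^ 2 * (1 / √(2 * z.1)) ^ 4) * (1 / √(2 * z.1)) := by ring
      _ ≤ μ * D * 1 * (1 / √z.1) := by
          gcongr ?_ * ?_
          · gcongr
          · exact hs z hz
      _ = μ * D / √z.1 := by ring
  refine ⟨μ * (2 * c * C) + μ * C, fun t z => m z.1 • H t z
    + fderiv ℝ (q t) (polar z) (A (polar z)) • (m' z.1 • ContinuousLinearMap.fst ℝ ℝ ℝ),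
    ?_, ?_, ?_, ?_, ?_⟩
  · intro t _ z hz
    have hd := hasFDerivAt_polar (hR.trans hz)
    exact ((hm z.1).comp_hasFDerivAt z hasFDerivAt_fst).mul
      (((h.hasFDerivAt_fderiv t (polar_mem_disk hε hz)).comp z hd).clm_apply
        (A.hasFDerivAt.comp z hd))
  · have h1 : Continuous fun x : ℝ × (ℝ × ℝ) => m x.2.1 := hcm.comp (by fun_prop)
    have h2 : Continuous fun x : ℝ × (ℝ × ℝ) => m' x.2.1 := hmc'.comp (by fun_prop)
    exact (h1.continuousOn.smul hHc).add
      (hval.smul (h2.continuousOn.smul continuousOn_const))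
  · intro z hz
    exact continuousOn_const.mul (hval.comp (f := fun t : ℝ => (t, z))
      (by fun_prop) fun t ht => ⟨ht, hz⟩)
  · intro t _ z hz
    rw [abs_mul]
    refine (hfin z hz hC0 (abs_nonneg _) (hμ _ hz) (hvb t z hz)).trans ?_
    gcongr
    have : 0 ≤ μ * (2 * c * C) := by positivity
    linarith
  · intro t _ z hz
    refine (norm_add_le _ _).trans ?_
    rw [add_div, norm_smul, norm_smul, norm_smul]
    refine add_le_add (hfin z hz (by positivity) (norm_nonneg _) (hμ _ hz) (hHb t z hz)) ?_
    refine le_trans ?_ (hfin z hz hC0 (abs_nonneg _) (hμ' _ hz) (hvb t z hz))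
    have hf := ContinuousLinearMap.norm_fst_le (𝕜 := ℝ) (E := ℝ) (F := ℝ)
    simp only [Real.norm_eq_abs]
    rw [mul_comm]
    refine mul_le_mul_of_nonneg_right ?_ (abs_nonneg _)
    calc _ ≤ |m' z.1| * 1 := mul_le_mul_of_nonneg_left hf (abs_nonneg _)
      _ = _ := mul_one _

end IsFlatRemainder
-- From iterated derivatives to a flat remainder
-- Currying is a linear isometry, so joint continuity in `(t, z)` passes from the iterated
-- derivative to `fderiv`.
theorem fderiv_eq_of_iteratedFDeriv (f : ℝ × ℝ → ℝ) (x : ℝ × ℝ) :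
    fderiv ℝ f x = continuousMultilinearCurryFin0 ℝ (ℝ × ℝ) (ℝ × ℝ →L[ℝ] ℝ)
      (continuousMultilinearCurryRightEquiv' ℝ 0 (ℝ × ℝ) ℝ (iteratedFDeriv ℝ 1 f x)) := by
  rw [iteratedFDeriv_succ_eq_comp_right (n := 0), Function.comp_apply,
    LinearIsometryEquiv.apply_symm_apply, iteratedFDeriv_zero_eq_comp, Function.comp_apply,
    LinearIsometryEquiv.apply_symm_apply]

theorem fderiv_fderiv_eq_of_iteratedFDeriv (f : ℝ × ℝ → ℝ) (x : ℝ × ℝ) :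
    fderiv ℝ (fderiv ℝ f) x =
      continuousMultilinearCurryFin0 ℝ (ℝ × ℝ) (ℝ × ℝ →L[ℝ] ℝ × ℝ →L[ℝ] ℝ)
        (continuousMultilinearCurryRightEquiv' ℝ 0 (ℝ × ℝ) (ℝ × ℝ →L[ℝ] ℝ)
          (continuousMultilinearCurryRightEquiv' ℝ 1 (ℝ × ℝ) ℝ (iteratedFDeriv ℝ 2 f x))) := by
  rw [iteratedFDeriv_succ_eq_comp_right (n := 1), Function.comp_apply,
    LinearIsometryEquiv.apply_symm_apply, iteratedFDeriv_succ_eq_comp_right (n := 0),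
    Function.comp_apply, LinearIsometryEquiv.apply_symm_apply, iteratedFDeriv_zero_eq_comp,
    Function.comp_apply, LinearIsometryEquiv.apply_symm_apply]

theorem isFlatRemainder_of_bounds {ε C : ℝ} {q : ℝ → ℝ × ℝ → ℝ} (hq : IsC0k 2 ε q)
    (hC : ∀ t, ∀ z ∈ disk ε, ∀ m, 1 ≤ m → m ≤ 2 →
      ‖iteratedFDeriv ℝ m (q t) z‖ ≤ C * (|z.1| ^ (4 + 1 - m) + |z.2| ^ (4 + 1 - m))) :
    IsFlatRemainder ε (2 * |C|) q where
  contDiffOn := hq.1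
  continuousOn_fderiv := by
    simp only [fderiv_eq_of_iteratedFDeriv]
    exact (LinearIsometryEquiv.continuous _).comp_continuousOn
      ((LinearIsometryEquiv.continuous _).comp_continuousOn (hq.2 1 (by norm_num)))
  continuousOn_fderiv_fderiv := by
    simp only [fderiv_fderiv_eq_of_iteratedFDeriv]
    exact (LinearIsometryEquiv.continuous _).comp_continuousOn
      ((LinearIsometryEquiv.continuous _).comp_continuousOn
        ((LinearIsometryEquiv.continuous _).comp_continuousOn (hq.2 2 le_rfl)))
  bound t w hw s h1 h2 := by
    have h := hC t w hw 1 le_rfl (by norm_num)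
    rw [norm_iteratedFDeriv_one] at h
    calc _ ≤ C * (|w.1| ^ 4 + |w.2| ^ 4) := h
      _ ≤ |C| * (s ^ 4 + s ^ 4) := by
        gcongr
        exact le_abs_self C
      _ = _ := by ring
  bound₂ t w hw s h1 h2 := by
    have h := hC t w hw 2 (by norm_num) le_rfl
    rw [← norm_iteratedFDeriv_fderiv (n := 1), norm_iteratedFDeriv_one] at h
    calc _ ≤ C * (|w.1| ^ 3 + |w.2| ^ 3) := h
      _ ≤ |C| * (s ^ 3 + s ^ 3) := by
        gcongr
        exact le_abs_self C
      _ = _ := by ring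

/-! ### The quartic part on the unit circle -/

/-- The restriction to the unit circle of the monomial `xⁱ yʲ`. -/
noncomputable def trigMonomial (ij : ℕ × ℕ) (θ : ℝ) : ℝ :=
  Real.cos θ ^ ij.1 * (-Real.sin θ) ^ ij.2

theorem contDiff_trigMonomial (ij : ℕ × ℕ) : ContDiff ℝ 2 (trigMonomial ij) :=
  (Real.contDiff_cos.pow _).mul (Real.contDiff_sin.neg.pow _)

theorem trigMonomial_add_two_pi (ij : ℕ × ℕ) (θ : ℝ) :
    trigMonomial ij (θ + 2 * Real.pi) = trigMonomial ij θ := by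
  simp [trigMonomial]

theorem deriv_trigMonomial_add_two_pi (ij : ℕ × ℕ) (θ : ℝ) :
    deriv (trigMonomial ij) (θ + 2 * Real.pi) = deriv (trigMonomial ij) θ := by
  rw [← deriv_comp_add_const]
  simp only [trigMonomial_add_two_pi]

/-- The restriction to the unit circle of a quartic form with coefficients depending on time. -/
noncomputable def quartic (α : ℕ → ℕ → ℝ → ℝ) (x : ℝ × ℝ) : ℝ :=
  ∑ ij ∈ Finset.HasAntidiagonal.antidiagonal 4, α ij.1 ij.2 x.1 * trigMonomial ij x.2

/-- The angular derivative of `quartic`. -/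
noncomputable def quarticDeriv (α : ℕ → ℕ → ℝ → ℝ) (x : ℝ × ℝ) : ℝ :=
  ∑ ij ∈ Finset.HasAntidiagonal.antidiagonal 4, α ij.1 ij.2 x.1 * deriv (trigMonomial ij) x.2

section Quartic

variable {α : ℕ → ℕ → ℝ → ℝ}

theorem contDiff_quartic (hα : ∀ i j, i + j = 4 → ContDiff ℝ 1 (α i j)) :
    ContDiff ℝ 1 (quartic α) :=
  ContDiff.sum fun ij hij => ((hα _ _ (Finset.HasAntidiagonal.mem_antidiagonal.1 hij)).comp
    contDiff_fst).mul
    (((contDiff_trigMonomial ij).of_le (by norm_num)).comp contDiff_snd)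

theorem contDiff_quarticDeriv (hα : ∀ i j, i + j = 4 → ContDiff ℝ 1 (α i j)) :
    ContDiff ℝ 1 (quarticDeriv α) :=
  ContDiff.sum fun ij hij => ((hα _ _ (Finset.HasAntidiagonal.mem_antidiagonal.1 hij)).comp
    contDiff_fst).mul
    ((ContDiff.deriv' (n := 1) (contDiff_trigMonomial ij)).comp contDiff_snd)

theorem hasDerivAt_quartic (α : ℕ → ℕ → ℝ → ℝ) (t θ : ℝ) :
    HasDerivAt (fun ϑ => quartic α (t, ϑ)) (quarticDeriv α (t, θ)) θ :=
  HasDerivAt.fun_sum fun ij _ =>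
    (((contDiff_trigMonomial ij).differentiable (by simp)) θ).hasDerivAt.const_mul
      (α ij.1 ij.2 t)

theorem quartic_add_two_pi (α : ℕ → ℕ → ℝ → ℝ) (t θ : ℝ) :
    quartic α (t, θ + 2 * Real.pi) = quartic α (t, θ) := by
  simp only [quartic, trigMonomial_add_two_pi]

theorem quarticDeriv_add_two_pi (α : ℕ → ℕ → ℝ → ℝ) (t θ : ℝ) :
    quarticDeriv α (t, θ + 2 * Real.pi) = quarticDeriv α (t, θ) := by
  simp only [quarticDeriv, deriv_trigMonomial_add_two_pi]

/-- For `r > R` one has `1 / r ≤ (1 / √R) / √r`, and differentiating `1 / r` only gains a further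
factor, at most `1 / R`. -/
theorem isDecaying_div_radius {A : ℝ × ℝ → ℝ} (hA : ContDiff ℝ 1 A) {R M : ℝ} (hR : 0 < R)
    (hM : ∀ t ∈ Icc (0 : ℝ) 1, ∀ θ, |A (t, θ)| ≤ M ∧ ‖fderiv ℝ A (t, θ)‖ ≤ M) :
    ∃ K f', IsDecaying R K (fun t z => A (t, z.2) * (2 * z.1⁻¹)) f' := by
  have hM0 : 0 ≤ M := (abs_nonneg _).trans (hM 0 (by simp) 0).1
  have hDA : Continuous (fderiv ℝ A) := hA.continuous_fderiv (by simp)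
  set P : ℝ × ℝ →L[ℝ] ℝ × ℝ := (0 : ℝ × ℝ →L[ℝ] ℝ).prod (ContinuousLinearMap.snd ℝ ℝ ℝ) with hP
  have hPn : ‖P‖ ≤ 1 := ContinuousLinearMap.opNorm_le_bound _ zero_le_one fun x => by
    simp [hP, Prod.norm_def]
  have hsR := Real.sqrt_pos.2 hR
  have hinv : ∀ z : ℝ × ℝ, R < z.1 → z.1⁻¹ ≤ 1 / √R / √z.1 ∧ z.1⁻¹ ≤ 1 / R := fun z hz => by
    have h0 : 0 < z.1 := hR.trans hz
    have h1 := Real.sqrt_pos.2 h0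
    have h2 : √R ≤ √z.1 := Real.sqrt_le_sqrt hz.le
    constructor
    · rw [div_div, ← one_div]
      refine one_div_le_one_div_of_le (by positivity) ?_
      calc √R * √z.1 ≤ √z.1 * √z.1 := by gcongr
        _ = z.1 := Real.mul_self_sqrt h0.le
    · rw [← one_div]
      gcongr
  refine ⟨(2 * M + 2 * M * (1 / R)) * (1 / √R), fun t z => A (t, z.2) •
      ((2 : ℝ) • (-(z.1 ^ 2)⁻¹ • ContinuousLinearMap.fst ℝ ℝ ℝ))
      + (2 * z.1⁻¹) • (fderiv ℝ A (t, z.2)).comp P, ?_, ?_, ?_, ?_, ?_⟩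
  · intro t _ z hz
    have h0 : z.1 ≠ 0 := (hR.trans hz).ne'
    have h1 : HasFDerivAt (fun z : ℝ × ℝ => (t, z.2)) P z :=
      (hasFDerivAt_const t z).prodMk hasFDerivAt_snd
    exact ((hA.differentiable (by simp) _).hasFDerivAt.comp z h1).mul
      (((hasDerivAt_inv h0).comp_hasFDerivAt z hasFDerivAt_fst).const_mul 2)
  · have hne : ∀ x ∈ Icc (0 : ℝ) 1 ×ˢ {z : ℝ × ℝ | R < z.1}, x.2.1 ≠ 0 :=
      fun x hx => (hR.trans hx.2).ne'
    have h1 : ContinuousOn (fun x : ℝ × (ℝ × ℝ) => x.2.1) (Icc 0 1 ×ˢ {z : ℝ × ℝ | R < z.1}) := by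
      fun_prop
    have h2 : Continuous fun x : ℝ × (ℝ × ℝ) => A (x.1, x.2.2) :=
      hA.continuous.comp (by fun_prop)
    have h3 : Continuous fun x : ℝ × (ℝ × ℝ) => (fderiv ℝ A (x.1, x.2.2)).comp P :=
      (hDA.comp (by fun_prop)).clm_comp continuous_const
    have h4 : ContinuousOn (fun x : ℝ × (ℝ × ℝ) => -(x.2.1 ^ 2)⁻¹)
        (Icc 0 1 ×ˢ {z : ℝ × ℝ | R < z.1}) :=
      ((h1.pow 2).inv₀ fun x hx => pow_ne_zero 2 (hne x hx)).neg
    have h5 : ContinuousOn (fun x : ℝ × (ℝ × ℝ) => 2 * x.2.1⁻¹)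
        (Icc 0 1 ×ˢ {z : ℝ × ℝ | R < z.1}) := continuousOn_const.mul (h1.inv₀ hne)
    exact (h2.continuousOn.smul ((h4.smul continuousOn_const).const_smul (2 : ℝ))).add
      (h5.smul h3.continuousOn)
  · intro z _
    exact ((hA.continuous.comp (by fun_prop)).mul continuous_const).continuousOn
  · intro t ht z hz
    have h0 : 0 < z.1 := hR.trans hz
    rw [abs_mul, abs_of_pos (a := 2 * z.1⁻¹) (by positivity)]
    calc _ ≤ M * (2 * (1 / √R / √z.1)) := by
          gcongr
          · exact (hM t ht _).1
          · exact (hinv z hz).1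
      _ = 2 * M * (1 / √R) / √z.1 := by ring
      _ ≤ _ := by
        gcongr
        have : 0 ≤ 2 * M * (1 / R) := by positivity
        linarith
  · intro t ht z hz
    have h0 : 0 < z.1 := hR.trans hz
    obtain ⟨h1, h2⟩ := hM t ht z.2
    have hf := ContinuousLinearMap.norm_fst_le (𝕜 := ℝ) ℝ ℝ
    refine (norm_add_le _ _).trans ?_
    rw [norm_smul, norm_smul, norm_smul, norm_smul, norm_neg, norm_inv, norm_pow, norm_mul,
      norm_inv, Real.norm_eq_abs z.1, abs_of_pos h0, Real.norm_two, Real.norm_eq_abs]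
    obtain ⟨i1, i2⟩ := hinv z hz
    calc _ ≤ M * (2 * ((1 / R * (1 / √R / √z.1)) * 1)) + 2 * (1 / √R / √z.1) * (M * 1) := by
          gcongr
          · rw [sq, mul_inv]
            gcongr
          · exact (ContinuousLinearMap.opNorm_comp_le _ _).trans
              (mul_le_mul h2 hPn (norm_nonneg _) hM0)
      _ = _ := by ring

end Quartic

/-! ### The regularized system as a perturbed twist -/

/-- Homogeneity of degree four extracts `√(2r) ^ (-4) = 1 / (4 r²)` from every monomial. -/
theorem pert_eq_quartic_add {ε : ℝ} (hε : 0 < ε) {p T g : ℝ → ℝ × ℝ → ℝ} {α : ℕ → ℕ → ℝ → ℝ}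
    (hsplit : ∀ t, ∀ z ∈ disk ε, p t z = T t z + g t z)
    (hT : ∀ t, ∀ z ∈ disk ε, T t z = ∑ ij ∈ Finset.HasAntidiagonal.antidiagonal 4,
      α ij.1 ij.2 t * z.1 ^ ij.1 * z.2 ^ ij.2)
    (t : ℝ) {r : ℝ} (hr : rStar ε < r) (θ : ℝ) :
    pert p t r θ = quartic α (t, θ) * (4 * r ^ 2)⁻¹ + pert g t r θ := by
  have hd : (Real.cos θ / √(2 * r), -Real.sin θ / √(2 * r)) ∈ disk ε :=
    polar_mem_disk hε (z := (r, θ)) hr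
  have h0 : 0 < r := (rStar_pos hε).trans hr
  have hs : √(2 * r) ^ 4 = 4 * r ^ 2 := by
    rw [show 4 = 2 * 2 by norm_num, pow_mul, Real.sq_sqrt (by linarith)]
    ring
  simp only [pert]
  rw [hsplit t _ hd, hT t _ hd, quartic, Finset.sum_mul]
  congr 1
  refine Finset.sum_congr rfl fun ij hij => ?_
  rw [trigMonomial, div_pow, div_pow, ← hs, ← Finset.HasAntidiagonal.mem_antidiagonal.1 hij, pow_add,
    mul_inv]
  simp only [div_eq_mul_inv]
  ring

/-- The weight `4 r²` exactly cancels the decay of the quartic part, which leaves a non-decaying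
term depending only on `(t, θ)`. -/
theorem fieldF_eq {ε C : ℝ} (hε : 0 < ε) {p g : ℝ → ℝ × ℝ → ℝ} {α : ℕ → ℕ → ℝ → ℝ}
    (hg : IsFlatRemainder ε C g)
    (hp : ∀ t, ∀ r > rStar ε, ∀ θ,
      pert p t r θ = quartic α (t, θ) * (4 * r ^ 2)⁻¹ + pert g t r θ)
    (t : ℝ) {r : ℝ} (hr : rStar ε < r) (θ : ℝ) :
    fieldF p t r θ = quarticDeriv α (t, θ)
      + 4 * r ^ 2 * fderiv ℝ (g t) (polar (r, θ)) (rot (polar (r, θ))) := by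
  have h0 : r ≠ 0 := ((rStar_pos hε).trans hr).ne'
  have h : HasDerivAt (fun ϑ => pert p t r ϑ) (quarticDeriv α (t, θ) * (4 * r ^ 2)⁻¹
      + fderiv ℝ (g t) (polar (r, θ)) (rot (polar (r, θ)))) θ :=
    (((hasDerivAt_quartic α t θ).mul_const _).add
      (hg.hasDerivAt_pert_angle hε t hr θ)).congr_of_eventuallyEq
      (Eventually.of_forall fun ϑ => hp t r hr ϑ)
  rw [fieldF, h.deriv]
  field_simp

/-- A radial derivative gains one more power of `r`, so here even the quartic part decays, like `1 /
r`. -/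
theorem fieldG_eq {ε C : ℝ} (hε : 0 < ε) {p g : ℝ → ℝ × ℝ → ℝ} {α : ℕ → ℕ → ℝ → ℝ}
    (hg : IsFlatRemainder ε C g)
    (hp : ∀ t, ∀ r > rStar ε, ∀ θ,
      pert p t r θ = quartic α (t, θ) * (4 * r ^ 2)⁻¹ + pert g t r θ)
    (t : ℝ) {r : ℝ} (hr : rStar ε < r) (θ : ℝ) :
    fieldG p t r θ = quartic α (t, θ) * (2 * r⁻¹)
      + 2 * r * fderiv ℝ (g t) (polar (r, θ)) (polar (r, θ)) := by
  have h0 : r ≠ 0 := ((rStar_pos hε).trans hr).ne'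
  have hi : HasDerivAt (fun ρ : ℝ => (4 * ρ ^ 2)⁻¹) (-(4 * (2 * r)) / (4 * r ^ 2) ^ 2) r := by
    have h1 : HasDerivAt (fun ρ : ℝ => 4 * ρ ^ 2) (4 * (2 * r)) r := by
      simpa using ((hasDerivAt_id r).pow 2).const_mul 4
    exact h1.inv (by positivity)
  have h : HasDerivAt (fun ρ => pert p t ρ θ) _ r :=
    ((hi.const_mul (quartic α (t, θ))).add
      (hg.hasDerivAt_pert_radius hε t hr θ)).congr_of_eventuallyEq
      ((lt_mem_nhds hr).mono fun ρ hρ => hp t ρ hρ θ)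
  rw [fieldG, h.deriv]
  field_simp
  ring

/-- Beyond the disk boundary, the regularized system is a small perturbation of a twist. -/
theorem exists_twistBounds {ε : ℝ} (hε : 0 < ε) {p : ℝ → ℝ × ℝ → ℝ}
    (hzero : IsZeroOfOrder 4 2 ε p) :
    ∃ K M B f g f' g', TwistBounds (rStar ε) K M B f g f' g' ∧
      ∀ t, ∀ z : ℝ × ℝ, rStar ε < z.1 →
        twistField B f g t z = (fieldF p t z.1 z.2, 2 * z.1 + fieldG p t z.1 z.2) := by
  obtain ⟨T, q, -, hq, hsplit, ⟨α, hα, hT⟩, C, hC⟩ := hzero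
  have hR := rStar_pos hε
  have hflat := isFlatRemainder_of_bounds hq fun t z hz => (hC t z hz).2
  have hpert := fun t r (hr : r > rStar ε) θ => pert_eq_quartic_add hε hsplit hT t hr θ
  obtain ⟨M₁, hM₁⟩ := exists_bound_of_periodic (contDiff_quartic hα) (quartic_add_two_pi α)
  obtain ⟨M, hM⟩ := exists_bound_of_periodic (contDiff_quarticDeriv hα)
    (quarticDeriv_add_two_pi α)
  -- With `R = rStar ε`, the derivative `8 r` of the weight is at most `(8 / R) r²`, whence `μ`.
  obtain ⟨K₁, f', hf⟩ := hflat.isDecaying hε norm_rot_le (m := fun r => 4 * r ^ 2)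
    (m' := fun r => 4 * (2 * r)) (μ := 4 + 8 / rStar ε)
    (fun r => by simpa using ((hasDerivAt_id r).pow 2).const_mul 4) (by fun_prop)
    (fun r hr => by
      rw [abs_of_nonneg (by positivity)]
      gcongr
      have : 0 < 8 / rStar ε := by positivity
      linarith)
    (fun r hr => by
      have h0 : 0 < r := hR.trans hr
      have h1 : r ≤ r ^ 2 / rStar ε := by
        rw [le_div_iff₀ hR]
        nlinarith
      rw [abs_of_nonneg (by positivity)]
      have : (4 + 8 / rStar ε) * r ^ 2 = 4 * r ^ 2 + 8 * (r ^ 2 / rStar ε) := by ring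
      nlinarith [sq_nonneg r])
  -- Similarly `2 r ≤ (2 / R) r²` and `2 ≤ (2 / R²) r²`.
  obtain ⟨K₂, g₁', hg₁⟩ := hflat.isDecaying hε (A := ContinuousLinearMap.id ℝ (ℝ × ℝ))
    ContinuousLinearMap.norm_id_le (m := fun r => 2 * r)
    (m' := fun _ => 2) (μ := 2 / rStar ε + 2 / rStar ε ^ 2)
    (fun r => by simpa using (hasDerivAt_id r).const_mul 2) (by fun_prop)
    (fun r hr => by
      have h0 : 0 < r := hR.trans hr
      have h1 : r ≤ r ^ 2 / rStar ε := by
        rw [le_div_iff₀ hR]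
        nlinarith
      rw [abs_of_nonneg (by positivity)]
      have : (2 / rStar ε + 2 / rStar ε ^ 2) * r ^ 2
        = 2 * (r ^ 2 / rStar ε) + 2 / rStar ε ^ 2 * r ^ 2 := by ring
      have h2 : 0 ≤ 2 / rStar ε ^ 2 * r ^ 2 := by positivity
      linarith)
    (fun r hr => by
      have h0 : 0 < r := hR.trans hr
      have h1 : 1 ≤ r ^ 2 / rStar ε ^ 2 := by
        rw [one_le_div (by positivity)]
        gcongr
      rw [abs_two]
      have : (2 / rStar ε + 2 / rStar ε ^ 2) * r ^ 2
        = 2 / rStar ε * r ^ 2 + 2 * (r ^ 2 / rStar ε ^ 2) := by ring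
      have h2 : 0 ≤ 2 / rStar ε * r ^ 2 := by positivity
      linarith)
  obtain ⟨K₃, g₂', hg₂⟩ := isDecaying_div_radius (contDiff_quartic hα) hR hM₁
  have hg := hg₂.add hg₁
  refine ⟨max K₁ (K₃ + K₂), M, quarticDeriv α, _, _, f', _,
    ⟨hR, contDiff_quarticDeriv hα, hM, hf.mono (le_max_left _ _), hg.mono (le_max_right _ _)⟩, ?_⟩
  intro t z hz
  rw [fieldF_eq hε hflat hpert t hz, fieldG_eq hε hflat hpert t hz]
  rfl

/-! ### The Poincaré map and the conclusion -/

theorem isSolution_iff {ε r₀ θ₀ : ℝ} {p : ℝ → ℝ × ℝ → ℝ} {V : ℝ → ℝ × ℝ → ℝ × ℝ}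
    (hV : ∀ t, ∀ z : ℝ × ℝ, rStar ε < z.1 →
      V t z = (fieldF p t z.1 z.2, 2 * z.1 + fieldG p t z.1 z.2)) {γ : ℝ → ℝ × ℝ} :
    IsSolution p ε r₀ θ₀ γ ↔ IsTrajectory V (rStar ε) (r₀, θ₀) γ :=
  ⟨fun h => ⟨h.init, h.mem, fun t ht => by rw [hV t _ (h.mem t ht)]; exact h.ode t ht⟩,
    fun h => ⟨h.init, h.mem, fun t ht => by rw [← hV t _ (h.mem t ht)]; exact h.ode t ht⟩⟩

theorem UniquelySolvable.poincare_eq {p : ℝ → ℝ × ℝ → ℝ} {ε r₀ θ₀ : ℝ}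
    (h : UniquelySolvable p ε r₀ θ₀) {γ : ℝ → ℝ × ℝ} (hγ : IsSolution p ε r₀ θ₀ γ) :
    poincare p ε r₀ θ₀ = γ 1 := by
  obtain ⟨δ, -, hδ⟩ := h
  have hex : ∃ γ, IsSolution p ε r₀ θ₀ γ := ⟨γ, hγ⟩
  rw [poincare, dif_pos hex, hδ _ hex.choose_spec (right_mem_Icc.2 zero_le_one),
    hδ _ hγ (right_mem_Icc.2 zero_le_one)]

theorem pert_add_two_pi (p : ℝ → ℝ × ℝ → ℝ) (t r θ : ℝ) :
    pert p t r (θ + 2 * Real.pi) = pert p t r θ := by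
  simp [pert]

theorem IsSolution.add_two_pi {p : ℝ → ℝ × ℝ → ℝ} {ε r₀ θ₀ : ℝ} {γ : ℝ → ℝ × ℝ}
    (h : IsSolution p ε r₀ θ₀ γ) :
    IsSolution p ε r₀ (θ₀ + 2 * Real.pi) (fun t => γ t + (0, 2 * Real.pi)) where
  init := by simp [h.init]
  mem t ht := by simpa using h.mem t ht
  ode t ht := by
    have hF : ∀ r θ, fieldF p t r (θ + 2 * Real.pi) = fieldF p t r θ := fun r θ => by
      rw [fieldF, ← deriv_comp_add_const]
      simp only [pert_add_two_pi, fieldF]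
    have hG : ∀ r θ, fieldG p t r (θ + 2 * Real.pi) = fieldG p t r θ := fun r θ => by
      simp only [fieldG, pert_add_two_pi]
    simpa [hF, hG] using (h.ode t ht).add_const (0, 2 * Real.pi)

end Vortex

theorem theorem3 (ε : ℝ) (hε : 0 < ε) (p : ℝ → ℝ × ℝ → ℝ)
    (hp : Vortex.ClassR 2 ε p) (hzero : Vortex.IsZeroOfOrder 4 2 ε p) :
    ∃ a : ℝ, Vortex.rStar ε < a ∧
      -- the Poincare map is well defined on the part `r₀ > a` of the cylinder
      (∀ r₀ > a, ∀ θ₀ : ℝ, Vortex.UniquelySolvable p ε r₀ θ₀) ∧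
      (∀ r₀ > a, ∀ θ₀ : ℝ,
        Vortex.poincare p ε r₀ (θ₀ + 2 * Real.pi)
          = Vortex.poincare p ε r₀ θ₀ + (0, 2 * Real.pi)) ∧
      -- the partial derivative exists there, and it tends to `2` uniformly in the angle
      (∀ r₀ > a, ∀ θ₀ : ℝ,
        DifferentiableAt ℝ (fun ρ => Vortex.angular p ε ρ θ₀) r₀) ∧
      TendstoUniformly (fun r₀ θ₀ : ℝ => Vortex.angularDr p ε r₀ θ₀) (fun _ => 2) atTop ∧
      -- the twist condition near the singularity
      ∃ a₂ ≥ a, ∀ r₀ > a₂, ∀ θ₀ : ℝ, 0 < Vortex.angularDr p ε r₀ θ₀ := by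
  obtain ⟨K, M, B, f, g, f', g', hb, hV⟩ := Vortex.exists_twistBounds hε hzero
  have hN : 0 ≤ M + K / √(Vortex.rStar ε) :=
    add_nonneg hb.nonneg.2 (div_nonneg hb.nonneg.1 (Real.sqrt_nonneg _))
  -- Starting above `R + N`, with `N` the bound on `r'`, guarantees existence. The `+ 1` keeps `a >
  -- rStar ε` even if `N = 0`.
  set a := Vortex.rStar ε + (M + K / √(Vortex.rStar ε)) + 1 with ha
  have hsol : ∀ r₀ > a, ∀ θ₀ : ℝ, Vortex.UniquelySolvable p ε r₀ θ₀ := by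
    intro r₀ hr₀ θ₀
    obtain ⟨γ, hγ⟩ := hb.exists_trajectory (z₀ := (r₀, θ₀)) (by simp only; linarith)
    exact ⟨γ, (Vortex.isSolution_iff hV).2 hγ,
      fun δ hδ => hb.eqOn ((Vortex.isSolution_iff hV).1 hδ) hγ⟩
  -- Uniqueness frees the Poincaré map from its arbitrary choice of solution. Derivatives are local,
  -- so agreement near `r₀` suffices.
  have hfam : ∀ θ₀ : ℝ, ∃ Γ : ℝ → ℝ → ℝ × ℝ,
      (∀ ρ > a, Vortex.IsTrajectory (Vortex.twistField B f g) (Vortex.rStar ε) (ρ, θ₀) (Γ ρ)) ∧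
      ∀ r₀ > a, (fun ρ => Vortex.angular p ε ρ θ₀) =ᶠ[𝓝 r₀] fun ρ => (Γ ρ 1).2 := by
    intro θ₀
    choose! Γ hΓ using fun ρ (hρ : ρ > a) => hsol ρ hρ θ₀
    refine ⟨Γ, fun ρ hρ => (Vortex.isSolution_iff hV).1 (hΓ ρ hρ).1, fun r₀ hr₀ => ?_⟩
    filter_upwards [lt_mem_nhds hr₀] with ρ hρ
    rw [Vortex.angular, (hsol ρ hρ θ₀).poincare_eq (hΓ ρ hρ).1]
  have hlim : ∀ η > 0, ∃ R₁, ∀ r₀ > a, R₁ < r₀ → ∀ θ₀, |Vortex.angularDr p ε r₀ θ₀ - 2| < η := by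
    intro η hη
    obtain ⟨R₁, hR₁⟩ := hb.exists_derivative_near_two hη
    refine ⟨R₁, fun r₀ hr₀ hr₁ θ₀ => ?_⟩
    obtain ⟨Γ, hΓ, he⟩ := hfam θ₀
    rw [Vortex.angularDr, (he r₀ hr₀).deriv_eq]
    exact hR₁ a θ₀ Γ hΓ r₀ hr₀ hr₁
  refine ⟨a, by linarith, hsol, fun r₀ hr₀ θ₀ => ?_, fun r₀ hr₀ θ₀ => ?_, ?_, ?_⟩
  · obtain ⟨γ, hγ, -⟩ := hsol r₀ hr₀ θ₀
    rw [(hsol r₀ hr₀ θ₀).poincare_eq hγ, (hsol r₀ hr₀ _).poincare_eq hγ.add_two_pi]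
  · obtain ⟨Γ, hΓ, he⟩ := hfam θ₀
    obtain ⟨X, -, -, hd⟩ := hb.exists_hasDerivAt hΓ hr₀
    exact (Vortex.hasDerivAt_snd hd).differentiableAt.congr_of_eventuallyEq (he r₀ hr₀)
  · rw [Metric.tendstoUniformly_iff]
    intro η hη
    obtain ⟨R₁, hR₁⟩ := hlim η hη
    filter_upwards [eventually_gt_atTop a, eventually_gt_atTop R₁] with r₀ h1 h2 θ₀
    rw [dist_comm, Real.dist_eq]
    exact hR₁ r₀ h1 h2 θ₀
  -- Being within `2` of the limit `2` already forces positivity.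
  · obtain ⟨R₁, hR₁⟩ := hlim 2 two_pos
    refine ⟨max a R₁, le_max_left _ _, fun r₀ hr₀ θ₀ => ?_⟩
    have := abs_lt.1 (hR₁ r₀ ((le_max_left _ _).trans_lt hr₀) ((le_max_right _ _).trans_lt hr₀) θ₀)
    linarith
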